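/- **Theorem 1.1.** Let $\hat D=\{x+iy\in\mathbb C:\ x^2+y^2\le 1,\ x\ge 0\}$ be the closed half unit disk, with boundary consisting of the diameter $\gamma=\{x=0,\ -1\le y\le 1\}$ and the half circle $\sigma=\{x^2+y^2=1,\ x\ge 0\}$. For $j=1,2,3$ let $\iota_j:\hat D\to\mathbb R^3$, $\iota_j(x+iy)=(x\cos\theta_j,\ y,\ x\sin\theta_j)$, with $\theta_j=0^\circ,120^\circ,240^\circ$ respectively, and let $YC=\iota_1(\hat D)\cup\iota_2(\hat D)\cup\iota_3(\hat D)$ be the standard flat $Y$-cone: three half unit disks glued along their common diameter at equal angles of $120^\circ$. Let $\mathbb B^3$ be the closed unit ball of $\mathbb R^3$. Let $u:YC\to\mathbb B^3$ be a map and put $u_j=u\circ\iota_j:\hat D\to\mathbb B^3$ (so $u_1=u_2=u_3$ on $\gamma$). Suppose that 1. (conformal immersion) each $u_j$ is smooth on $\hat D$ up to its boundary, and at every point of $\hat D$ its differential is a nonzero multiple of a linear isometry, with respect to the flat metric of $\hat D$; 2. (minimal $Y$-surface) each immersion $u_j$ has zero mean curvature, and at every point of $\gamma$ any two of the three outward unit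 conormals of the faces $u_1,u_2,u_3$ along $\gamma$ make an angle of $120^\circ$; 3. (orthogonality to the sphere) each $u_j$ maps $\sigma$ into the unit sphere $\partial\mathbb B^3$, and along $\sigma$ the outward unit conormal of the face $u_j$ is normal to $\partial\mathbb B^3$. Then $u(YC)$ is a flat $Y$-cone: there is a linear isometry $R$ of $\mathbb R^3$ with $u(YC)=R(YC)$. -/

import Mathlib

open scoped ContDiff

noncomputable section

/-- Euclidean three-space. -/
abbrev Space3 : Type := EuclideanSpace ℝ (Fin 3)

/-- The closed half disk `{x² + y² ≤ 1, x ≥ 0}` in the plane. -/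
def halfDisk : Set ℂ := {z | z.re ^ 2 + z.im ^ 2 ≤ 1 ∧ 0 ≤ z.re}

/-- The diameter `{x = 0, -1 ≤ y ≤ 1}` of the half disk. -/
def diameterSide : Set ℂ := {z | z.re = 0 ∧ -1 ≤ z.im ∧ z.im ≤ 1}

/-- The half circle `{x² + y² = 1, x ≥ 0}` of the half disk. -/
def arcSide : Set ℂ := {z | z.re ^ 2 + z.im ^ 2 = 1 ∧ 0 ≤ z.re}

/-- The isometric embedding of the plane in space whose restriction to the half disk
parametrizes the `j`-th face of the standard Y-cone: the `(x₁, x₂)`-plane rotated by the angle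
`2πj/3` about the `x₂`-axis. -/
def faceEmbedding (j : Fin 3) (z : ℂ) : Space3 :=
  !₂[z.re * Real.cos (2 * Real.pi * (j : ℝ) / 3), z.im,
    z.re * Real.sin (2 * Real.pi * (j : ℝ) / 3)]

/-- The standard flat Y-cone: three half unit disks with a common diameter, meeting there at
equal angles of 120 degrees. -/
def standardYCone : Set Space3 := ⋃ j : Fin 3, faceEmbedding j '' halfDisk

/-- A map on the Y-cone read on the `j`-th face, in the coordinate `z` of the half disk. Only its
values on the half disk matter. On the diameter the three face maps agree, since the three
face embeddings do. -/
def faceMap (u : Space3 → Space3) (j : Fin 3) : ℂ → Space3 := fun z => u (faceEmbedding j z)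

/-- The differential of a map on the half disk (one-sided at boundary points). -/
def faceDeriv (f : ℂ → Space3) (z : ℂ) : ℂ →L[ℝ] Space3 := fderivWithin ℝ f halfDisk z

/-- The coordinate directions `∂/∂x` and `∂/∂y` of the plane. -/
def coordDir : Fin 2 → ℂ := ![1, Complex.I]

/-- First partial derivatives on the half disk. -/
def facePartial (i : Fin 2) (f : ℂ → Space3) : ℂ → Space3 :=
  fun z => faceDeriv f z (coordDir i)

/-- The first fundamental form `g_{ij} = ⟨∂_i f, ∂_j f⟩`. -/
def firstFundamentalForm (f : ℂ → Space3) (z : ℂ) : Matrix (Fin 2) (Fin 2) ℝ :=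
  Matrix.of fun i j => inner ℝ (facePartial i f z) (facePartial j f z)

/-- The vector-valued second fundamental form `A_{ij} = (∂_i ∂_j f)^⊥`, where `⊥` is the
orthogonal projection to the normal space of the immersion. -/
def secondFundamentalForm (f : ℂ → Space3) (z : ℂ) (i j : Fin 2) : Space3 :=
  (LinearMap.range (faceDeriv f z).toLinearMap)ᗮ.starProjection
    (facePartial i (facePartial j f) z)

/-- The mean curvature vector `g^{ij} A_{ij}` (the trace of the second fundamental form) of an
immersion of the half disk. -/
def meanCurvatureVector (f : ℂ → Space3) (z : ℂ) : Space3 :=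
  ∑ i : Fin 2, ∑ j : Fin 2, ((firstFundamentalForm f z)⁻¹ i j) • secondFundamentalForm f z i j

/-- The unit conormal at `z` of the immersed face `f`, along a boundary curve of the half disk
whose outward unit normal at `z` is `ν` (so its tangent there is `iν`): the unit vector tangent to
the face, orthogonal to the image of the boundary curve, and pointing out of the face. -/
def outerConormal (f : ℂ → Space3) (z ν : ℂ) : Space3 :=
  let t : Space3 := faceDeriv f z (Complex.I * ν)
  let w : Space3 := faceDeriv f z ν - (inner ℝ t (faceDeriv f z ν) / ‖t‖ ^ 2) • t
  ‖w‖⁻¹ • w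

/-- A conformal immersion of the Y-cone with its flat metric: on each (closed) face it is smooth
up to the boundary, and its differential is at every point a nonzero multiple of a linear
isometry. -/
def IsConformalYImmersion (u : Space3 → Space3) : Prop :=
  ∀ j : Fin 3, ContDiffOn ℝ ∞ (faceMap u j) halfDisk ∧
    ∀ z ∈ halfDisk, IsConformalMap (faceDeriv (faceMap u j) z)

/-- Minimality of an immersed Y-surface: the mean curvature of the faces vanishes, and along the
junction the outer conormals of the three faces form a Y, any two of them making an angle of
120 degrees. The outward normal of the half disk along its diameter is `-1`. -/
def IsMinimalYSurface (u : Space3 → Space3) : Prop :=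
  (∀ j : Fin 3, ∀ z ∈ halfDisk, meanCurvatureVector (faceMap u j) z = 0) ∧
    ∀ z ∈ diameterSide, ∀ i j : Fin 3, i ≠ j →
      InnerProductGeometry.angle (outerConormal (faceMap u i) z (-1))
        (outerConormal (faceMap u j) z (-1)) = 2 * Real.pi / 3

/-- The surface meets the unit sphere orthogonally: the half circles are mapped into the sphere,
and there the conormal of the face is normal to the sphere, that is, a multiple of the position
vector. The outward normal of the half disk at a point `z` of the half circle is `z`. -/
def MeetsSphereOrthogonally (u : Space3 → Space3) : Prop :=
  ∀ j : Fin 3, ∀ z ∈ arcSide, faceMap u j z ∈ Metric.sphere (0 : Space3) 1 ∧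
    outerConormal (faceMap u j) z z ∈ ℝ ∙ faceMap u j z

/-- A flat Y-cone (free boundary, in the unit ball): the image of the standard one under a linear
isometry of space. -/
def IsFlatYCone (S : Set Space3) : Prop :=
  ∃ R : Space3 ≃ₗᵢ[ℝ] Space3, S = R '' standardYCone

end

/-! In conformal coordinates a minimal face `f` is harmonic, so `F = ∂ₓf - i ∂ᵧf` is a holomorphic
isotropic vector. The relation `F × F' = -i h F` then defines a holomorphic function `h`, the
coefficient of the Hopf differential (`IsConformalHarmonic.hopf_mul`), and `h = 0` means that the
face is flat.

The boundary conditions force `h = 0`. Along the half circle, orthogonality to the sphere makes the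
boundary a line of curvature (Joachimsthal), so `z² h` is real there. Along the diameter `z²` is
real. The three conormals form a rigid `Y` turning about the junction, so the imaginary parts of the
three `h_j` coincide (`IsHarmonicY.tripleProduct_X_Q`). The conormals sum to zero, so the real parts
sum to zero (`IsHarmonicY.sum_tripleProduct_X_P`). Hence the differences of the `z² h_j` are real on
the whole boundary; being constant (`eq_const_of_real_on_boundary`) and zero at the origin, they
vanish. The common function is now imaginary on the diameter and real on the arc, so its square is
real on the whole boundary and vanishes for the same reason (`IsHarmonicY.hopf_eq_zero`).

Each face therefore lies in a plane, which orthogonality to the sphere places through the origin. In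
this plane it is a holomorphic immersion `g` carrying arc to unit circle and diameter to imaginary
axis. The quotient `(1 + g²) / (g' (1 + z²))` is real on the boundary and tends to 1 at the corners,
so it is 1 (`IsHalfDiskImmersion.one_add_sq_eq`). Integrating, `g` is a disk automorphism fixing
`±i`, and its image is exactly the half disk. The conormals at the origin place the three half disks
at 120 degrees. -/

/-! ### Geometry of the half disk -/

theorem halfDisk_eq : halfDisk = Metric.closedBall (0 : ℂ) 1 ∩ {z | 0 ≤ z.re} := by
  ext z
  simp only [halfDisk, Set.mem_ofPred_eq, Set.mem_inter_iff, Metric.mem_closedBall, dist_zero_right]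
  rw [← sq_le_one_iff₀ (norm_nonneg z), Complex.sq_norm, Complex.normSq_apply]
  simp [sq]

theorem isClosed_halfDisk : IsClosed halfDisk := by
  rw [halfDisk_eq]
  exact Metric.isClosed_closedBall.inter (isClosed_le continuous_const Complex.continuous_re)

theorem convex_halfDisk : Convex ℝ halfDisk := by
  rw [halfDisk_eq]
  exact (convex_closedBall _ _).inter (convex_halfSpace_re_ge 0)

theorem mem_interior_halfDisk {z : ℂ} :
    z ∈ interior halfDisk ↔ z.re ^ 2 + z.im ^ 2 < 1 ∧ 0 < z.re := by
  rw [halfDisk_eq, interior_inter, interior_closedBall _ one_ne_zero,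
    Complex.interior_setOfPred_le_re, Set.mem_inter_iff, Metric.mem_ball, dist_zero_right,
    ← sq_lt_one_iff₀ (norm_nonneg z), Complex.sq_norm, Complex.normSq_apply]
  simp [sq]

theorem half_mem_interior_halfDisk : (1 / 2 : ℂ) ∈ interior halfDisk := by
  rw [mem_interior_halfDisk]; norm_num

theorem closure_interior_halfDisk : closure (interior halfDisk) = halfDisk := by
  rw [convex_halfDisk.closure_interior_eq_closure_of_nonempty_interior
    ⟨_, half_mem_interior_halfDisk⟩, isClosed_halfDisk.closure_eq]

theorem uniqueDiffOn_halfDisk : UniqueDiffOn ℝ halfDisk :=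
  uniqueDiffOn_convex convex_halfDisk ⟨_, half_mem_interior_halfDisk⟩

theorem diameterSide_subset : diameterSide ⊆ halfDisk := by
  rintro z ⟨h, h1, h2⟩
  refine ⟨?_, h.ge⟩
  rw [h]; nlinarith

theorem arcSide_subset : arcSide ⊆ halfDisk := fun _ h => ⟨h.1.le, h.2⟩

theorem halfDisk_sdiff_interior_subset :
    halfDisk \ interior halfDisk ⊆ diameterSide ∪ arcSide := by
  rintro z ⟨⟨h1, h2⟩, h⟩
  rw [mem_interior_halfDisk, not_and_or] at h
  rcases h with h | h
  · exact .inr ⟨by linarith, h2⟩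
  · have h0 : z.re = 0 := by linarith
    rw [h0] at h1
    exact .inl ⟨h0, by nlinarith, by nlinarith⟩

/-! ### Holomorphic functions with real boundary values -/

theorem hasDerivWithinAt_of_hasFDerivWithinAt_real {h : ℂ → ℂ} {L : ℂ →L[ℝ] ℂ} {s : Set ℂ}
    {z : ℂ} (hL : HasFDerivWithinAt h L s z) (hI : L Complex.I = Complex.I * L 1) :
    HasDerivWithinAt h (L 1) s z := by
  have h1 : HasFDerivWithinAt h (ContinuousLinearMap.toSpanSingleton ℂ (L 1)) s z := by
    refine .of_isLittleO (hL.isLittleO.congr_left fun w => ?_)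
    have h2 : L (w - z) = (w - z) * L 1 := by
      conv_lhs => rw [← Complex.re_add_im (w - z)]
      have h3 : ((w - z).re : ℂ) + ((w - z).im : ℂ) * Complex.I
          = (w - z).re • (1 : ℂ) + (w - z).im • Complex.I := by simp
      rw [h3, map_add, map_smul, map_smul, hI, Complex.real_smul, Complex.real_smul]
      conv_rhs => rw [← Complex.re_add_im (w - z)]
      ring
    rw [h2]; simp
  simpa using h1.hasDerivWithinAt

/-- A map which is holomorphic inside a set and real there has zero derivative. -/
theorem hasDerivAt_zero_of_im_eq_zero {h : ℂ → ℂ} {s : Set ℂ} (hs : IsOpen s)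
    (hd : DifferentiableOn ℂ h s) (him : ∀ z ∈ s, (h z).im = 0) {z : ℂ} (hz : z ∈ s) :
    HasDerivAt h 0 z := by
  have h1 := (hd.differentiableAt (hs.mem_nhds hz)).hasDerivAt
  have h2 := Complex.imCLM.hasFDerivAt.comp z (h1.hasFDerivAt.restrictScalars ℝ)
  have h3 : HasFDerivAt (Complex.imCLM ∘ h) (0 : ℂ →L[ℝ] ℝ) z :=
    (hasFDerivAt_const (0 : ℝ) z).congr_of_eventuallyEq
      (Filter.eventually_of_mem (hs.mem_nhds hz) fun w hw => him w hw)
  have h4 := h2.unique h3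
  have e1 := DFunLike.congr_fun h4 1
  have e2 := DFunLike.congr_fun h4 Complex.I
  simp at e1 e2
  have : deriv h z = 0 := Complex.ext e2 e1
  rwa [this] at h1

theorem eq_of_hasDerivAt_zero {h : ℂ → ℂ} (hc : ContinuousOn h halfDisk)
    (hd : ∀ z ∈ interior halfDisk, HasDerivAt h 0 z) :
    ∃ c, ∀ z ∈ halfDisk, h z = c := by
  obtain ⟨c, hcst⟩ := isOpen_interior.exists_is_const_of_deriv_eq_zero
    (convex_halfDisk.interior.isPreconnected)
    (fun z hz => (hd z hz).differentiableAt.differentiableWithinAt) (fun z hz => (hd z hz).deriv)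
  refine ⟨c, ?_⟩
  have : Set.EqOn h (fun _ => c) (closure (interior halfDisk)) :=
    Set.EqOn.of_subset_closure (fun z hz => hcst z hz)
      (by rwa [closure_interior_halfDisk]) continuousOn_const subset_closure subset_rfl
  rwa [closure_interior_halfDisk] at this

/-- A continuous function on the half disk, holomorphic inside and real on the boundary, is
a real constant. -/
theorem eq_const_of_real_on_boundary {h : ℂ → ℂ} (hc : ContinuousOn h halfDisk)
    (hd : DifferentiableOn ℂ h (interior halfDisk))
    (hdiam : ∀ z ∈ diameterSide, (h z).im = 0) (harc : ∀ z ∈ arcSide, (h z).im = 0) :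
    ∃ c : ℝ, ∀ z ∈ halfDisk, h z = c := by
  -- Maximum modulus for `exp (a h)` with `a` imaginary: its norm is 1 where `h` is real. The
  -- choices `a = ±i` bound the imaginary part of `h` from both sides.
  have key : ∀ a : ℂ, a.re = 0 → ∀ z ∈ halfDisk, ‖Complex.exp (a * h z)‖ ≤ 1 := by
    intro a ha z hz
    refine Complex.norm_le_of_forall_mem_frontier_norm_le (U := interior halfDisk)
      (f := fun z => Complex.exp (a * h z)) ?_ ⟨?_, ?_⟩ ?_ (by rwa [closure_interior_halfDisk])
    · rw [halfDisk_eq]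
      exact Metric.isBounded_closedBall.subset (interior_subset.trans Set.inter_subset_left)
    · exact ((differentiableOn_const a).mul hd).cexp
    · rw [closure_interior_halfDisk]
      exact (continuousOn_const.mul hc).cexp
    · intro w hw
      rw [frontier, closure_interior_halfDisk, interior_interior] at hw
      have : (h w).im = 0 := by
        rcases halfDisk_sdiff_interior_subset hw with hw | hw
        exacts [hdiam w hw, harc w hw]
      rw [Complex.norm_exp]
      simp [ha, this]
  have him : ∀ z ∈ halfDisk, (h z).im = 0 := by
    intro z hz
    have h1 := key Complex.I rfl z hz
    have h2 := key (-Complex.I) (by simp) z hz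
    rw [Complex.norm_exp, Real.exp_le_one_iff] at h1 h2
    simp at h1 h2
    linarith
  obtain ⟨c, hcst⟩ := eq_of_hasDerivAt_zero hc
    (fun z hz => hasDerivAt_zero_of_im_eq_zero isOpen_interior hd
      (fun w hw => him w (interior_subset hw)) hz)
  refine ⟨c.re, fun z hz => ?_⟩
  rw [hcst z hz]
  refine Complex.ext rfl ?_
  rw [← hcst z hz, him z hz]; simp

/-! ### Minimal conformal immersions are harmonic -/

/-- The real linear map on the plane with the given partial derivatives. -/
noncomputable def planarDeriv {E : Type*} [NormedAddCommGroup E] [NormedSpace ℝ E] (a b : E) :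
    ℂ →L[ℝ] E :=
  Complex.reCLM.smulRight a + Complex.imCLM.smulRight b

@[simp]
theorem planarDeriv_apply {E : Type*} [NormedAddCommGroup E] [NormedSpace ℝ E] (a b : E) (w : ℂ) :
    planarDeriv a b w = w.re • a + w.im • b := rfl

theorem eq_planarDeriv {E : Type*} [NormedAddCommGroup E] [NormedSpace ℝ E] (L : ℂ →L[ℝ] E) :
    L = planarDeriv (L 1) (L Complex.I) := by
  ext w
  conv_lhs => rw [← Complex.re_add_im w]
  have h : (w.re : ℂ) + (w.im : ℂ) * Complex.I = w.re • (1 : ℂ) + w.im • Complex.I := by simp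
  rw [h, map_add, map_smul, map_smul, planarDeriv_apply]

/-- A conformal harmonic immersion of the half disk, with first partial derivatives `X`, `Y` and
second partial derivatives `P = ∂ₓX = -∂ᵧY` and `Q = ∂ᵧX = ∂ₓY`. -/
structure IsConformalHarmonic (f X Y P Q : ℂ → Space3) : Prop where
  hasFDerivWithinAt : ∀ z ∈ halfDisk, HasFDerivWithinAt f (planarDeriv (X z) (Y z)) halfDisk z
  hasFDerivWithinAt_X : ∀ z ∈ halfDisk, HasFDerivWithinAt X (planarDeriv (P z) (Q z)) halfDisk z
  hasFDerivWithinAt_Y : ∀ z ∈ halfDisk, HasFDerivWithinAt Y (planarDeriv (Q z) (-P z)) halfDisk z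
  continuousOn_P : ContinuousOn P halfDisk
  continuousOn_Q : ContinuousOn Q halfDisk
  inner_X_X : ∀ z ∈ halfDisk, inner ℝ (X z) (X z) = inner ℝ (Y z) (Y z)
  inner_X_Y : ∀ z ∈ halfDisk, inner ℝ (X z) (Y z) = 0
  inner_P_X : ∀ z ∈ halfDisk, inner ℝ (P z) (X z) = inner ℝ (Q z) (Y z)
  inner_P_Y : ∀ z ∈ halfDisk, inner ℝ (P z) (Y z) = -inner ℝ (Q z) (X z)
  pos : ∀ z ∈ halfDisk, 0 < inner ℝ (X z) (X z)

theorem contDiffOn_facePartial {f : ℂ → Space3} (hf : ContDiffOn ℝ ∞ f halfDisk) (i : Fin 2) :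
    ContDiffOn ℝ ∞ (facePartial i f) halfDisk :=
  (hf.fderivWithin uniqueDiffOn_halfDisk (by simp)).clm_apply contDiffOn_const

theorem hasFDerivWithinAt_facePartial {f : ℂ → Space3} (hf : ContDiffOn ℝ ∞ f halfDisk) {z : ℂ}
    (hz : z ∈ halfDisk) :
    HasFDerivWithinAt f (planarDeriv (facePartial 0 f z) (facePartial 1 f z)) halfDisk z := by
  have h := (hf.differentiableOn (by simp) z hz).hasFDerivWithinAt
  rw [eq_planarDeriv (fderivWithin ℝ f halfDisk z)] at h
  simpa [facePartial, faceDeriv, coordDir] using h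

theorem facePartial_comm {f : ℂ → Space3} (hf : ContDiffOn ℝ ∞ f halfDisk) {z : ℂ}
    (hz : z ∈ halfDisk) (i j : Fin 2) :
    facePartial i (facePartial j f) z = facePartial j (facePartial i f) z := by
  have key : ∀ i j : Fin 2, facePartial i (facePartial j f) z =
      fderivWithin ℝ (fderivWithin ℝ f halfDisk) halfDisk z (coordDir i) (coordDir j) := by
    intro i j
    have h1 : DifferentiableWithinAt ℝ (fderivWithin ℝ f halfDisk) halfDisk z :=
      (hf.fderivWithin (m := ∞) uniqueDiffOn_halfDisk (by simp)).differentiableOn (by simp) z hz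
    have h2 := (h1.hasFDerivWithinAt.clm_apply
      (hasFDerivWithinAt_const (coordDir j) z halfDisk)).fderivWithin (uniqueDiffOn_halfDisk z hz)
    refine (DFunLike.congr_fun h2 (coordDir i)).trans ?_
    simp
  rw [key, key]
  exact (hf z hz).isSymmSndFDerivWithinAt (by simpa using WithTop.coe_le_coe.2 (le_top (a := (2 : ℕ∞)))) uniqueDiffOn_halfDisk
    (by rwa [closure_interior_halfDisk]) hz _ _

/-- The two conformality identities are differentiated in both coordinate directions. Neither
symmetry of second derivatives nor harmonicity enters, so the result is available for proving
harmonicity. -/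
theorem inner_partials_of_conformal {X Y P Q Q' W : ℂ → Space3}
    (hX : ∀ z ∈ halfDisk, HasFDerivWithinAt X (planarDeriv (P z) (Q z)) halfDisk z)
    (hY : ∀ z ∈ halfDisk, HasFDerivWithinAt Y (planarDeriv (Q' z) (W z)) halfDisk z)
    (hXX : ∀ z ∈ halfDisk, inner ℝ (X z) (X z) = inner ℝ (Y z) (Y z))
    (hXY : ∀ z ∈ halfDisk, inner ℝ (X z) (Y z) = 0) {z : ℂ} (hz : z ∈ halfDisk) :
    inner ℝ (P z) (X z) = inner ℝ (Q' z) (Y z) ∧ inner ℝ (Q z) (X z) = inner ℝ (W z) (Y z) ∧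
      inner ℝ (P z) (Y z) = -inner ℝ (Q' z) (X z) ∧
      inner ℝ (W z) (X z) = -inner ℝ (Q z) (Y z) := by
  have hu := uniqueDiffOn_halfDisk z hz
  have h1 := (((hX z hz).inner ℝ (hX z hz)).sub ((hY z hz).inner ℝ (hY z hz))).congr
    (f₁ := fun _ => (0 : ℝ)) (fun w hw => (sub_eq_zero.2 (hXX w hw)).symm) (sub_eq_zero.2 (hXX z hz)).symm
  have h2 := ((hX z hz).inner ℝ (hY z hz)).congr
    (f₁ := fun _ => (0 : ℝ)) (fun w hw => by simp [hXY w hw]) (by simp [hXY z hz])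
  have e1 := hu.eq h1 (hasFDerivWithinAt_const (0 : ℝ) z halfDisk)
  have e2 := hu.eq h2 (hasFDerivWithinAt_const (0 : ℝ) z halfDisk)
  have a1 := DFunLike.congr_fun e1 1
  have a2 := DFunLike.congr_fun e1 Complex.I
  have a3 := DFunLike.congr_fun e2 1
  have a4 := DFunLike.congr_fun e2 Complex.I
  simp at a1 a2 a3 a4
  have c1 := real_inner_comm (P z) (X z)
  have c2 := real_inner_comm (Q' z) (Y z)
  have c3 := real_inner_comm (Q z) (X z)
  have c4 := real_inner_comm (W z) (Y z)
  have c5 := real_inner_comm (Q' z) (X z)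
  have c6 := real_inner_comm (W z) (X z)
  refine ⟨?_, ?_, ?_, ?_⟩ <;> linarith

theorem inner_facePartial_of_isConformalMap {f : ℂ → Space3} {z : ℂ}
    (h : IsConformalMap (faceDeriv f z)) :
    0 < inner ℝ (facePartial 0 f z) (facePartial 0 f z) ∧
      inner ℝ (facePartial 0 f z) (facePartial 0 f z) =
        inner ℝ (facePartial 1 f z) (facePartial 1 f z) ∧
      inner ℝ (facePartial 0 f z) (facePartial 1 f z) = 0 := by
  obtain ⟨c, hc, h⟩ := (isConformalMap_iff _).1 h
  simp only [facePartial, h]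
  simp [coordDir, Complex.inner, hc]

theorem isConformalHarmonic_of_minimal {f : ℂ → Space3} (hf : ContDiffOn ℝ ∞ f halfDisk)
    (hconf : ∀ z ∈ halfDisk, IsConformalMap (faceDeriv f z))
    (hmin : ∀ z ∈ halfDisk, meanCurvatureVector f z = 0) :
    IsConformalHarmonic f (facePartial 0 f) (facePartial 1 f)
      (facePartial 0 (facePartial 0 f)) (facePartial 0 (facePartial 1 f)) := by
  have hX : ∀ z ∈ halfDisk, HasFDerivWithinAt (facePartial 0 f) (planarDeriv
      (facePartial 0 (facePartial 0 f) z) (facePartial 0 (facePartial 1 f) z)) halfDisk z := by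
    intro z hz
    rw [facePartial_comm hf hz 0 1]
    exact hasFDerivWithinAt_facePartial (contDiffOn_facePartial hf 0) hz
  have hY : ∀ z ∈ halfDisk, HasFDerivWithinAt (facePartial 1 f) (planarDeriv
      (facePartial 0 (facePartial 1 f) z) (facePartial 1 (facePartial 1 f) z)) halfDisk z :=
    fun z hz => hasFDerivWithinAt_facePartial (contDiffOn_facePartial hf 1) hz
  have hin := fun z hz => inner_facePartial_of_isConformalMap (hconf z hz)
  have hrel := fun z hz => inner_partials_of_conformal (z := z) hX hY (fun z hz => (hin z hz).2.1)
    (fun z hz => (hin z hz).2.2) hz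
  have hharm : ∀ z ∈ halfDisk,
      facePartial 1 (facePartial 1 f) z = -facePartial 0 (facePartial 0 f) z := by
    intro z hz
    obtain ⟨hpos, hXX, hXY⟩ := hin z hz
    obtain ⟨r1, r2, r3, r4⟩ := hrel z hz
    -- By the differentiated conformality relations the Laplacian is already normal to the surface,
    -- so the normal projection in the mean curvature loses nothing. The metric being a multiple of
    -- the identity, zero mean curvature then means zero Laplacian.
    have hmem : facePartial 0 (facePartial 0 f) z + facePartial 1 (facePartial 1 f) z ∈
        (LinearMap.range (faceDeriv f z).toLinearMap)ᗮ := by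
      rw [Submodule.mem_orthogonal]
      rintro _ ⟨w, rfl⟩
      have : (faceDeriv f z).toLinearMap w = w.re • facePartial 0 f z + w.im • facePartial 1 f z := by
        change faceDeriv f z w = _
        rw [eq_planarDeriv (faceDeriv f z)]; simp [facePartial, coordDir]
      rw [this, real_inner_comm]
      simp only [inner_add_left, inner_add_right, inner_smul_right]
      linear_combination w.re * (r1 + r4) + w.im * (r3 - r2)
    have hinv : (firstFundamentalForm f z)⁻¹ =
        (inner ℝ (facePartial 0 f z) (facePartial 0 f z))⁻¹ • 1 := by
      refine Matrix.inv_eq_right_inv ?_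
      ext i j
      fin_cases i <;> fin_cases j <;>
        simp [firstFundamentalForm, hXY, real_inner_comm, -inner_self_eq_norm_sq_to_K]
      · exact inv_mul_cancel₀ hpos.ne'
      · rw [← hXX]; exact inv_mul_cancel₀ hpos.ne'
    have h0 := hmin z hz
    simp only [meanCurvatureVector, hinv, Fin.sum_univ_two, Matrix.smul_apply, Matrix.one_apply,
      secondFundamentalForm] at h0
    simp only [if_true, if_false, zero_ne_one, one_ne_zero, zero_smul, add_zero, zero_add, smul_eq_mul, mul_one, mul_zero, ← smul_add, ← map_add] at h0
    rw [Submodule.starProjection_eq_self_iff.2 hmem] at h0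
    exact (neg_eq_of_add_eq_zero_right ((smul_eq_zero_iff_right (inv_ne_zero hpos.ne')).1 h0)).symm
  refine ⟨fun z hz => hasFDerivWithinAt_facePartial hf hz, hX, fun z hz => hharm z hz ▸ hY z hz,
    (contDiffOn_facePartial (contDiffOn_facePartial hf 0) 0).continuousOn,
    (contDiffOn_facePartial (contDiffOn_facePartial hf 1) 0).continuousOn,
    fun z hz => (hin z hz).2.1, fun z hz => (hin z hz).2.2,
    fun z hz => (hrel z hz).1, fun z hz => (hrel z hz).2.2.1, fun z hz => (hin z hz).1⟩

/-! ### The Hopf differential and its holomorphy -/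

/-- The determinant of three vectors of space. -/
noncomputable def tripleProduct (a b c : Space3) : ℝ :=
  (a 1 * b 2 - a 2 * b 1) * c 0 + (a 2 * b 0 - a 0 * b 2) * c 1 + (a 0 * b 1 - a 1 * b 0) * c 2

theorem space3_inner (a b : Space3) : inner ℝ a b = a 0 * b 0 + a 1 * b 1 + a 2 * b 2 := by
  rw [PiLp.inner_apply, Fin.sum_univ_three]
  simp [mul_comm]

/-- The complex combination `a - i b` of two vectors, by coordinates. -/
noncomputable def complexPair (a b : Space3) (k : Fin 3) : ℂ := (a k : ℂ) - Complex.I * (b k : ℂ)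

/-- The coefficient of the Hopf differential. -/
noncomputable def hopf (X Y P Q : ℂ → Space3) (z : ℂ) : ℂ :=
  ((tripleProduct (X z) (Y z) (P z) : ℂ) - Complex.I * (tripleProduct (X z) (Y z) (Q z) : ℂ)) /
    (inner ℝ (X z) (X z) : ℝ)

section Hopf

variable {f X Y P Q : ℂ → Space3}

theorem IsConformalHarmonic.isotropic (h : IsConformalHarmonic f X Y P Q) {z : ℂ}
    (hz : z ∈ halfDisk) :
    complexPair (X z) (Y z) 0 ^ 2 + complexPair (X z) (Y z) 1 ^ 2 +
      complexPair (X z) (Y z) 2 ^ 2 = 0 := by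
  have h1 := h.inner_X_X z hz
  have h2 := h.inner_X_Y z hz
  rw [space3_inner] at h1 h2
  rw [space3_inner] at h1
  apply Complex.ext <;> simp [complexPair, sq] <;> linarith

theorem IsConformalHarmonic.isotropic_deriv (h : IsConformalHarmonic f X Y P Q) {z : ℂ}
    (hz : z ∈ halfDisk) :
    complexPair (X z) (Y z) 0 * complexPair (P z) (Q z) 0 +
      complexPair (X z) (Y z) 1 * complexPair (P z) (Q z) 1 +
      complexPair (X z) (Y z) 2 * complexPair (P z) (Q z) 2 = 0 := by
  have h1 := h.inner_P_X z hz
  have h2 := h.inner_P_Y z hz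
  rw [space3_inner, space3_inner] at h1 h2
  apply Complex.ext <;> simp [complexPair] <;> linarith

/-- With `F = X - iY` and `G = P - iQ = F'`, the relations `F·F = F·G = 0` make `F × G` parallel to
`F`; pairing with the conjugate of `F` identifies the factor. Wherever a component of `F` is
nonzero, `hopf` is thus a quotient of holomorphic functions, although its definition is not visibly
holomorphic. -/
theorem IsConformalHarmonic.hopf_mul (h : IsConformalHarmonic f X Y P Q) {z : ℂ}
    (hz : z ∈ halfDisk) (k : Fin 3) :
    hopf X Y P Q z * complexPair (X z) (Y z) k = Complex.I *
      (complexPair (X z) (Y z) (k + 1) * complexPair (P z) (Q z) (k + 2) -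
        complexPair (X z) (Y z) (k + 2) * complexPair (P z) (Q z) (k + 1)) := by
  have hE : ((inner ℝ (X z) (X z) : ℝ) : ℂ) ≠ 0 := by exact_mod_cast (h.pos z hz).ne'
  have hFF := h.isotropic hz
  have hFG := h.isotropic_deriv hz
  have hE2 : 2 * ((inner ℝ (X z) (X z) : ℝ) : ℂ) =
      ∑ k, complexPair (X z) (Y z) k * ((X z k : ℂ) + Complex.I * (Y z k : ℂ)) := by
    have h1 := h.inner_X_X z hz
    rw [space3_inner, space3_inner] at h1
    rw [space3_inner, Fin.sum_univ_three]
    apply Complex.ext <;> simp [complexPair] <;> linarith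
  have hdet : -2 * Complex.I * ((tripleProduct (X z) (Y z) (P z) : ℂ) -
      Complex.I * (tripleProduct (X z) (Y z) (Q z) : ℂ)) =
      ∑ k, ((X z k : ℂ) + Complex.I * (Y z k : ℂ)) *
      (complexPair (X z) (Y z) (k + 1) * complexPair (P z) (Q z) (k + 2) -
        complexPair (X z) (Y z) (k + 2) * complexPair (P z) (Q z) (k + 1)) := by
    rw [Fin.sum_univ_three]
    apply Complex.ext <;> simp [complexPair, tripleProduct] <;> ring
  rw [hopf, div_mul_eq_mul_div, div_eq_iff hE]
  have hI : Complex.I * Complex.I = -1 := Complex.I_mul_I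
  rw [Fin.sum_univ_three] at hE2 hdet
  simp only [show (0 : Fin 3) + 1 = 1 from rfl, show (0 : Fin 3) + 2 = 2 from rfl, show (1 : Fin 3) + 1 = 2 from rfl,
      show (2 : Fin 3) + 1 = 0 from rfl, show (1 : Fin 3) + 2 = 0 from rfl,
      show (2 : Fin 3) + 2 = 1 from rfl] at hdet
  generalize (X z 0 : ℂ) + Complex.I * (Y z 0 : ℂ) = c0 at *
  generalize (X z 1 : ℂ) + Complex.I * (Y z 1 : ℂ) = c1 at *
  generalize (X z 2 : ℂ) + Complex.I * (Y z 2 : ℂ) = c2 at *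
  generalize ((tripleProduct (X z) (Y z) (P z) : ℂ) -
      Complex.I * (tripleProduct (X z) (Y z) (Q z) : ℂ)) = T at *
  generalize ((inner ℝ (X z) (X z) : ℝ) : ℂ) = E at *
  generalize complexPair (X z) (Y z) = F at *
  generalize complexPair (P z) (Q z) = G at *
  -- Components of `(F × G) × F = (F·F) G - (F·G) F = 0`.
  have h01 : (F 1 * G 2 - F 2 * G 1) * F 1 = (F 2 * G 0 - F 0 * G 2) * F 0 := by
    linear_combination G 2 * hFF - F 2 * hFG
  have h12 : (F 2 * G 0 - F 0 * G 2) * F 2 = (F 0 * G 1 - F 1 * G 0) * F 1 := by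
    linear_combination G 0 * hFF - F 0 * hFG
  have h20 : (F 0 * G 1 - F 1 * G 0) * F 0 = (F 1 * G 2 - F 2 * G 1) * F 2 := by
    linear_combination G 1 * hFF - F 1 * hFG
  have hT : 2 * T = Complex.I * (c0 * (F 1 * G 2 - F 2 * G 1) + c1 * (F 2 * G 0 - F 0 * G 2) +
      c2 * (F 0 * G 1 - F 1 * G 0)) := by
    linear_combination Complex.I * hdet + 2 * T * hI
  fin_cases k <;> simp [show (1 : Fin 3) + 1 = 2 from rfl,
      show (2 : Fin 3) + 1 = 0 from rfl, show (1 : Fin 3) + 2 = 0 from rfl,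
      show (2 : Fin 3) + 2 = 1 from rfl]
  · linear_combination (1 / 2) * (F 0 * hT - Complex.I * (F 1 * G 2 - F 2 * G 1) * hE2 - Complex.I * c1 * h01 + Complex.I * c2 * h20)
  · linear_combination (1 / 2) * (F 1 * hT - Complex.I * (F 2 * G 0 - F 0 * G 2) * hE2 + Complex.I * c0 * h01 - Complex.I * c2 * h12)
  · linear_combination (1 / 2) * (F 2 * hT - Complex.I * (F 0 * G 1 - F 1 * G 0) * hE2 - Complex.I * c0 * h20 + Complex.I * c1 * h12)

theorem IsConformalHarmonic.exists_complexPair_ne_zero (h : IsConformalHarmonic f X Y P Q) {z : ℂ}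
    (hz : z ∈ halfDisk) : ∃ k, complexPair (X z) (Y z) k ≠ 0 := by
  by_contra! hall
  have hp := h.pos z hz
  have hr : ∀ k, X z k = 0 := fun k => by simpa [complexPair] using congrArg Complex.re (hall k)
  rw [space3_inner, hr, hr, hr] at hp
  norm_num at hp

theorem hasFDerivWithinAt_coord {g : ℂ → Space3} {a b : Space3} {z : ℂ}
    (h : HasFDerivWithinAt g (planarDeriv a b) halfDisk z) (k : Fin 3) :
    HasFDerivWithinAt (fun w => g w k) (planarDeriv (a k) (b k)) halfDisk z := by
  have := (EuclideanSpace.proj (𝕜 := ℝ) k).hasFDerivAt.comp_hasFDerivWithinAt z h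
  refine this.congr_fderiv ?_
  ext <;> simp

theorem IsConformalHarmonic.hasDerivWithinAt_complexPair (h : IsConformalHarmonic f X Y P Q) {z : ℂ}
    (hz : z ∈ halfDisk) (k : Fin 3) :
    HasDerivWithinAt (fun w => complexPair (X w) (Y w) k) (complexPair (P z) (Q z) k) halfDisk z := by
  have h1 := Complex.ofRealCLM.hasFDerivAt.comp_hasFDerivWithinAt z
    (hasFDerivWithinAt_coord (h.hasFDerivWithinAt_X z hz) k)
  have h2 := Complex.ofRealCLM.hasFDerivAt.comp_hasFDerivWithinAt z
    (hasFDerivWithinAt_coord (h.hasFDerivWithinAt_Y z hz) k)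
  have h3 := h1.sub (h2.const_mul Complex.I)
  have h4 := hasDerivWithinAt_of_hasFDerivWithinAt_real h3 (by
    simp only [sub_apply, ContinuousLinearMap.comp_apply, planarDeriv_apply,
      smul_apply]
    apply Complex.ext <;> simp)
  refine h4.congr_deriv ?_
  simp [complexPair]

theorem IsConformalHarmonic.continuousOn_X (h : IsConformalHarmonic f X Y P Q) :
    ContinuousOn X halfDisk := fun z hz => (h.hasFDerivWithinAt_X z hz).continuousWithinAt

theorem IsConformalHarmonic.continuousOn_Y (h : IsConformalHarmonic f X Y P Q) :
    ContinuousOn Y halfDisk := fun z hz => (h.hasFDerivWithinAt_Y z hz).continuousWithinAt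

theorem IsConformalHarmonic.continuousOn_hopf (h : IsConformalHarmonic f X Y P Q) :
    ContinuousOn (hopf X Y P Q) halfDisk := by
  have hX := h.continuousOn_X
  have hY := h.continuousOn_Y
  have hP := h.continuousOn_P
  have hQ := h.continuousOn_Q
  refine ContinuousOn.div ?_ (Complex.continuous_ofReal.comp_continuousOn (hX.inner hX))
    fun z hz => by exact_mod_cast (h.pos z hz).ne'
  unfold tripleProduct
  fun_prop

theorem IsConformalHarmonic.hasDerivAt_complexPair (h : IsConformalHarmonic f X Y P Q) {z : ℂ}
    (hz : z ∈ interior halfDisk) (k : Fin 3) :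
    HasDerivAt (fun w => complexPair (X w) (Y w) k) (complexPair (P z) (Q z) k) z :=
  (h.hasDerivWithinAt_complexPair (interior_subset hz) k).hasDerivAt
    (mem_interior_iff_mem_nhds.1 hz)

theorem IsConformalHarmonic.differentiableOn_complexPair (h : IsConformalHarmonic f X Y P Q)
    (k : Fin 3) :
    DifferentiableOn ℂ (fun w => complexPair (X w) (Y w) k) (interior halfDisk) :=
  fun _ hz => (h.hasDerivAt_complexPair hz k).differentiableAt.differentiableWithinAt

theorem IsConformalHarmonic.differentiableOn_complexPair_deriv
    (h : IsConformalHarmonic f X Y P Q) (k : Fin 3) :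
    DifferentiableOn ℂ (fun w => complexPair (P w) (Q w) k) (interior halfDisk) :=
  ((h.differentiableOn_complexPair k).deriv isOpen_interior).congr
    fun _ hz => (h.hasDerivAt_complexPair hz k).deriv.symm

/-- The Hopf differential of a conformal harmonic map is holomorphic. -/
theorem IsConformalHarmonic.differentiableOn_hopf (h : IsConformalHarmonic f X Y P Q) :
    DifferentiableOn ℂ (hopf X Y P Q) (interior halfDisk) := by
  intro z hz
  have hnhds := mem_interior_iff_mem_nhds.1 hz
  obtain ⟨k, hk⟩ := h.exists_complexPair_ne_zero (interior_subset hz)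
  have hF := fun l => (h.differentiableOn_complexPair l).differentiableAt
    (isOpen_interior.mem_nhds hz)
  have hG := fun l => (h.differentiableOn_complexPair_deriv l).differentiableAt
    (isOpen_interior.mem_nhds hz)
  refine DifferentiableAt.differentiableWithinAt ?_
  have hq := ((((hF (k + 1)).mul (hG (k + 2))).sub ((hF (k + 2)).mul (hG (k + 1)))).const_mul
    Complex.I).div (hF k) hk
  refine hq.congr_of_eventuallyEq ?_
  filter_upwards [hnhds, (hF k).continuousAt.eventually_ne hk] with w hw hwk
  simpa using (eq_div_iff hwk).2 (h.hopf_mul hw k)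

end Hopf

/-! ### Orthogonality to the sphere along the half circle -/

section Arc

variable {f X Y P Q : ℂ → Space3}

theorem IsConformalHarmonic.faceDeriv_eq (h : IsConformalHarmonic f X Y P Q) {z : ℂ}
    (hz : z ∈ halfDisk) : faceDeriv f z = planarDeriv (X z) (Y z) :=
  (h.hasFDerivWithinAt z hz).fderivWithin (uniqueDiffOn_halfDisk z hz)

theorem IsConformalHarmonic.inner_planarDeriv (h : IsConformalHarmonic f X Y P Q) {z : ℂ}
    (hz : z ∈ halfDisk) (v w : ℂ) :
    inner ℝ (planarDeriv (X z) (Y z) v) (planarDeriv (X z) (Y z) w) =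
      inner ℝ (X z) (X z) * (v.re * w.re + v.im * w.im) := by
  have h1 := h.inner_X_X z hz
  have h2 := h.inner_X_Y z hz
  have h3 := real_inner_comm (X z) (Y z)
  simp only [planarDeriv_apply, inner_add_left, inner_add_right, real_inner_smul_left,
    real_inner_smul_right, h3, h2, ← h1]
  ring

theorem IsConformalHarmonic.outerConormal_eq (h : IsConformalHarmonic f X Y P Q) {z : ℂ}
    (hz : z ∈ halfDisk) (ν : ℂ) :
    outerConormal f z ν = ‖planarDeriv (X z) (Y z) ν‖⁻¹ • planarDeriv (X z) (Y z) ν := by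
  have h0 : inner ℝ (planarDeriv (X z) (Y z) (Complex.I * ν)) (planarDeriv (X z) (Y z) ν) = 0 := by
    rw [h.inner_planarDeriv hz]
    simp; ring_nf; simp
  simp only [outerConormal, h.faceDeriv_eq hz, h0, zero_div, zero_smul, sub_zero]

theorem IsConformalHarmonic.planarDeriv_ne_zero (h : IsConformalHarmonic f X Y P Q) {z : ℂ}
    (hz : z ∈ halfDisk) {v : ℂ} (hv : v ≠ 0) : planarDeriv (X z) (Y z) v ≠ 0 := by
  intro h0
  have h1 := h.inner_planarDeriv hz v v
  rw [h0, inner_zero_left] at h1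
  have h2 : 0 < v.re * v.re + v.im * v.im := by
    rw [← Complex.normSq_apply]; exact Complex.normSq_pos.2 hv
  exact (mul_pos (h.pos z hz) h2).ne h1

theorem ne_zero_of_mem_arcSide {z : ℂ} (hz : z ∈ arcSide) : z ≠ 0 := by
  rintro rfl
  have := hz.1
  norm_num at this

/-- By conformality the conormal along the arc is the normalized radial derivative. The factor is
nonzero because the map is an immersion. -/
theorem IsConformalHarmonic.radial_eq_smul (h : IsConformalHarmonic f X Y P Q) {z : ℂ}
    (hz : z ∈ arcSide) (horth : outerConormal f z z ∈ Submodule.span ℝ {f z}) :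
    ∃ m : ℝ, m ≠ 0 ∧ planarDeriv (X z) (Y z) z = m • f z := by
  have hz' := arcSide_subset hz
  have hne := h.planarDeriv_ne_zero hz' (ne_zero_of_mem_arcSide hz)
  rw [h.outerConormal_eq hz', Submodule.mem_span_singleton] at horth
  obtain ⟨a, ha⟩ := horth
  have hm : planarDeriv (X z) (Y z) z = (‖planarDeriv (X z) (Y z) z‖ * a) • f z := by
    rw [mul_smul, ha, smul_inv_smul₀ (norm_ne_zero_iff.2 hne)]
  refine ⟨_, fun h0 => hne ?_, hm⟩
  rw [hm, h0, zero_smul]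

theorem circleMap_mem_arcSide {θ : ℝ} (hθ : θ ∈ Set.Icc (-(Real.pi / 2)) (Real.pi / 2)) :
    circleMap 0 1 θ ∈ arcSide := by
  simp only [circleMap_zero, Complex.ofReal_one, one_mul, arcSide, Set.mem_ofPred_eq,
    Complex.exp_ofReal_mul_I_re, Complex.exp_ofReal_mul_I_im]
  exact ⟨Real.cos_sq_add_sin_sq θ, Real.cos_nonneg_of_mem_Icc hθ⟩

theorem exists_circleMap_eq {z : ℂ} (hz : z ∈ arcSide) :
    ∃ θ ∈ Set.Icc (-(Real.pi / 2)) (Real.pi / 2), circleMap 0 1 θ = z := by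
  refine ⟨z.arg, ?_, ?_⟩
  · exact abs_le.1 (Complex.abs_arg_le_pi_div_two_iff.2 hz.2)
  · have h1 : ‖z‖ = 1 := by
      rw [← sq_eq_sq₀ (norm_nonneg z) zero_le_one, Complex.sq_norm, Complex.normSq_apply]
      linarith [hz.1]
    have := Complex.norm_mul_exp_arg_mul_I z
    rw [h1] at this
    simpa [circleMap_zero] using this

/-- Here `c` and `s` are the cosine and sine of the polar angle, and `h'` is `h` differentiated
along the arc. Taking the determinant with `x`, `y` kills all tangential terms, including `v`, which
is tangential since `m ≠ 0`; only the second derivatives survive. -/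
theorem tripleProduct_of_radial {x y p q v : Space3} {c s m m' m'' : ℝ} (hm : m ≠ 0)
    (h : c • x + s • y = m • v)
    (h' : c • (-s • p + c • q) + -s • x + (s • (-s • q + c • -p) + c • y) =
      m' • (-s • x + c • y) + m'' • v) :
    2 * c * s * tripleProduct x y p = (c ^ 2 - s ^ 2) * tripleProduct x y q := by
  have e := fun k : Fin 3 => congrArg (fun w : Space3 => w k) h
  have e' := fun k : Fin 3 => congrArg (fun w : Space3 => w k) h'
  simp only [PiLp.add_apply, PiLp.smul_apply, PiLp.neg_apply, smul_eq_mul] at e e'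
  have hv : tripleProduct x y v = 0 := by
    refine (mul_eq_zero.1 ?_).resolve_left hm
    unfold tripleProduct
    linear_combination -(x 1 * y 2 - x 2 * y 1) * e 0 - (x 2 * y 0 - x 0 * y 2) * e 1 -
      (x 0 * y 1 - x 1 * y 0) * e 2
  have hv' : (2 * c * s * tripleProduct x y p - (c ^ 2 - s ^ 2) * tripleProduct x y q) +
      m'' * tripleProduct x y v = 0 := by
    unfold tripleProduct
    linear_combination -(x 1 * y 2 - x 2 * y 1) * e' 0 - (x 2 * y 0 - x 0 * y 2) * e' 1 -
      (x 0 * y 1 - x 1 * y 0) * e' 2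
  rw [hv, mul_zero, add_zero] at hv'
  exact sub_eq_zero.1 hv'

/-- Joachimsthal: a curve along which a surface meets the unit sphere orthogonally is a
line of curvature. -/
theorem IsConformalHarmonic.im_sq_mul_hopf_arc (h : IsConformalHarmonic f X Y P Q)
    (hnorm : ∀ z ∈ arcSide, ‖f z‖ = 1)
    (horth : ∀ z ∈ arcSide, outerConormal f z z ∈ Submodule.span ℝ {f z}) :
    ∀ z ∈ arcSide, (z ^ 2 * hopf X Y P Q z).im = 0 := by
  intro z hz
  obtain ⟨θ, hθ, rfl⟩ := exists_circleMap_eq hz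
  set S := Set.Icc (-(Real.pi / 2)) (Real.pi / 2)
  have hSu : UniqueDiffWithinAt ℝ S θ := uniqueDiffOn_Icc (by linarith [Real.pi_pos]) θ hθ
  have hmaps : Set.MapsTo (circleMap 0 1) S halfDisk :=
    fun t ht => arcSide_subset (circleMap_mem_arcSide ht)
  have hc : HasDerivWithinAt (circleMap 0 1) (circleMap 0 1 θ * Complex.I) S θ :=
    (hasDerivAt_circleMap 0 1 θ).hasDerivWithinAt
  have hzD := hmaps hθ
  have dX := (h.hasFDerivWithinAt_X _ hzD).comp_hasDerivWithinAt θ hc hmaps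
  have dY := (h.hasFDerivWithinAt_Y _ hzD).comp_hasDerivWithinAt θ hc hmaps
  have df := (h.hasFDerivWithinAt _ hzD).comp_hasDerivWithinAt θ hc hmaps
  have dcos := (Real.hasDerivAt_cos θ).hasDerivWithinAt (s := S)
  have dsin := (Real.hasDerivAt_sin θ).hasDerivWithinAt (s := S)
  have dR := (dcos.smul dX).add (dsin.smul dY)
  have hre : ∀ t, (circleMap 0 1 t).re = Real.cos t := fun t => by
    simp [circleMap_zero, Complex.exp_ofReal_mul_I_re]
  have him : ∀ t, (circleMap 0 1 t).im = Real.sin t := fun t => by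
    simp [circleMap_zero, Complex.exp_ofReal_mul_I_im]
  have dm := dR.inner ℝ df
  have dmf := dm.smul df
  have hR : ∀ t ∈ S, ∃ m : ℝ, m ≠ 0 ∧ Real.cos t • X (circleMap 0 1 t) +
      Real.sin t • Y (circleMap 0 1 t) = m • f (circleMap 0 1 t) := by
    intro t ht
    have hm := circleMap_mem_arcSide ht
    simpa [hre, him] using h.radial_eq_smul hm (horth _ hm)
  -- The multiplier is known only pointwise; since `f` has unit length it equals an inner product,
  -- which can be differentiated.
  have hEq : ∀ t ∈ S, Real.cos t • X (circleMap 0 1 t) + Real.sin t • Y (circleMap 0 1 t) =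
      (inner ℝ (Real.cos t • X (circleMap 0 1 t) + Real.sin t • Y (circleMap 0 1 t))
        (f (circleMap 0 1 t)) : ℝ) • f (circleMap 0 1 t) := by
    intro t ht
    obtain ⟨m, -, hm⟩ := hR t ht
    rw [hm, real_inner_smul_left, real_inner_self_eq_norm_sq, hnorm _ (circleMap_mem_arcSide ht)]
    norm_num
  have key := hSu.eq_deriv _ (dR.congr_of_mem (fun t ht => (hEq t ht).symm) hθ) dmf
  obtain ⟨m, hm0, hm⟩ := hR θ hθ
  simp only [planarDeriv_apply, Complex.mul_I_re, Complex.mul_I_im, hre, him, Function.comp] at key hm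
  obtain ⟨m', m'', key⟩ : ∃ m' m'' : ℝ, _ = m' • _ + m'' • f (circleMap 0 1 θ) := ⟨_, _, key⟩
  have htri := tripleProduct_of_radial hm0 hm key
  have hz2 : (circleMap 0 1 θ) ^ 2 = ((Real.cos θ ^ 2 - Real.sin θ ^ 2 : ℝ) : ℂ) +
      ((2 * Real.cos θ * Real.sin θ : ℝ) : ℂ) * Complex.I := by
    conv_lhs => rw [← Complex.re_add_im (circleMap 0 1 θ), hre, him]
    simp only [Complex.ofReal_sub, Complex.ofReal_mul, Complex.ofReal_pow, Complex.ofReal_ofNat]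
    linear_combination (Real.sin θ : ℂ) ^ 2 * Complex.I_sq
  rw [hz2, hopf, mul_div_assoc', Complex.div_ofReal_im, div_eq_zero_iff]
  left
  simp only [Complex.mul_im, Complex.mul_re, Complex.add_re, Complex.add_im, Complex.sub_re,
    Complex.sub_im, Complex.ofReal_re, Complex.ofReal_im, Complex.I_re, Complex.I_im]
  linear_combination htri

end Arc

/-! ### The 120 degree condition along the junction -/

theorem tripleProduct_sq {a y b : Space3} (hay : inner ℝ a y = 0) (hyb : inner ℝ y b = 0) :
    tripleProduct a y b ^ 2 =
      inner ℝ y y * (inner ℝ a a * inner ℝ b b - inner ℝ a b ^ 2) := by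
  rw [space3_inner] at hay hyb
  simp only [space3_inner, tripleProduct]
  linear_combination (2 * (y 0 * b 0 + y 1 * b 1 + y 2 * b 2) * (a 0 * b 0 + a 1 * b 1 + a 2 * b 2) -
    (b 0 * b 0 + b 1 * b 1 + b 2 * b 2) * (a 0 * y 0 + a 1 * y 1 + a 2 * y 2)) * hay -
    (a 0 * a 0 + a 1 * a 1 + a 2 * a 2) * (y 0 * b 0 + y 1 * b 1 + y 2 * b 2) * hyb

/-- For vectors `a`, `b` of equal length at an angle of 120 degrees in the plane orthogonal to `y`,
the cross product of `a` with `y` is proportional to `b - (-a - b)`. -/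
theorem tripleProduct_of_balanced {a b y : Space3} {E : ℝ} (haa : inner ℝ a a = E)
    (hbb : inner ℝ b b = E) (hyy : inner ℝ y y = E) (hab : inner ℝ a b = -E / 2)
    (hay : inner ℝ a y = 0) (hby : inner ℝ b y = 0) (q : Space3) :
    3 * E * tripleProduct a y q = 2 * tripleProduct a y b * (2 * inner ℝ b q + inner ℝ a q) := by
  have hk := tripleProduct_sq hay (by rw [real_inner_comm, hby] : inner ℝ y b = 0)
  rw [haa, hbb, hyy, hab] at hk
  set K := tripleProduct a y b with hK
  have hc : tripleProduct a y q = (a 1 * y 2 - a 2 * y 1) * q 0 + (a 2 * y 0 - a 0 * y 2) * q 1 +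
    (a 0 * y 1 - a 1 * y 0) * q 2 := rfl
  rw [tripleProduct] at hK
  rw [space3_inner] at haa hbb hyy hab hay hby
  -- The vector `3E (a × y) - 2K (2b + a)` has zero length: `|a × y|² = E²`, `|2b + a|² = 3E`, the
  -- inner product of these two vectors is `2K`, and `K² = 3E³/4`.
  have hsq : (3 * E * (a 1 * y 2 - a 2 * y 1) - 2 * K * (2 * b 0 + a 0)) ^ 2 +
      (3 * E * (a 2 * y 0 - a 0 * y 2) - 2 * K * (2 * b 1 + a 1)) ^ 2 +
      (3 * E * (a 0 * y 1 - a 1 * y 0) - 2 * K * (2 * b 2 + a 2)) ^ 2 = 0 := by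
    have hcc : (a 1 * y 2 - a 2 * y 1) ^ 2 + (a 2 * y 0 - a 0 * y 2) ^ 2 +
        (a 0 * y 1 - a 1 * y 0) ^ 2 = E ^ 2 := by
      linear_combination (y 0 * y 0 + y 1 * y 1 + y 2 * y 2) * haa + E * hyy -
        (a 0 * y 0 + a 1 * y 1 + a 2 * y 2) * hay
    have hdd : (2 * b 0 + a 0) ^ 2 + (2 * b 1 + a 1) ^ 2 + (2 * b 2 + a 2) ^ 2 = 3 * E := by
      linear_combination 4 * hbb + 4 * hab + haa
    linear_combination 9 * E ^ 2 * hcc + 4 * K ^ 2 * hdd - 12 * E * hk + 24 * E * K * hK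
  have h0 := sq_nonneg (3 * E * (a 1 * y 2 - a 2 * y 1) - 2 * K * (2 * b 0 + a 0))
  have h1 := sq_nonneg (3 * E * (a 2 * y 0 - a 0 * y 2) - 2 * K * (2 * b 1 + a 1))
  have h2 := sq_nonneg (3 * E * (a 0 * y 1 - a 1 * y 0) - 2 * K * (2 * b 2 + a 2))
  have e0 := pow_eq_zero_iff (two_ne_zero) |>.1 (le_antisymm (by linarith) h0)
  have e1 := pow_eq_zero_iff (two_ne_zero) |>.1 (le_antisymm (by linarith) h1)
  have e2 := pow_eq_zero_iff (two_ne_zero) |>.1 (le_antisymm (by linarith) h2)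
  rw [hc, space3_inner, space3_inner]
  linear_combination q 0 * e0 + q 1 * e1 + q 2 * e2

theorem mem_diameterSide {y : ℝ} (hy : y ∈ Set.Icc (-1 : ℝ) 1) : (y : ℂ) * Complex.I ∈ diameterSide :=
  ⟨by simp, by simpa using hy.1, by simpa using hy.2⟩

theorem exists_of_mem_diameterSide {z : ℂ} (hz : z ∈ diameterSide) :
    ∃ y ∈ Set.Icc (-1 : ℝ) 1, (y : ℂ) * Complex.I = z :=
  ⟨z.im, hz.2, Complex.ext (by simp [hz.1]) (by simp)⟩

theorem hasDerivWithinAt_diameter {E : Type*} [NormedAddCommGroup E] [NormedSpace ℝ E]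
    {g : ℂ → E} {a b : E} {y : ℝ}
    (h : HasFDerivWithinAt g (planarDeriv a b) halfDisk ((y : ℂ) * Complex.I)) :
    HasDerivWithinAt (fun t : ℝ => g ((t : ℂ) * Complex.I)) b (Set.Icc (-1) 1) y := by
  have hc : HasDerivWithinAt (fun t : ℝ => (t : ℂ) * Complex.I) Complex.I (Set.Icc (-1) 1) y := by
    simpa using ((Complex.ofRealCLM.hasDerivAt (x := y)).mul_const Complex.I).hasDerivWithinAt
  have := h.comp_hasDerivWithinAt y hc fun t ht => diameterSide_subset (mem_diameterSide ht)
  exact this.congr_deriv (by simp)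

theorem uniqueDiffWithinAt_diameter {y : ℝ} (hy : y ∈ Set.Icc (-1 : ℝ) 1) :
    UniqueDiffWithinAt ℝ (Set.Icc (-1 : ℝ) 1) y :=
  uniqueDiffOn_Icc (by norm_num) y hy

theorem inner_eq_of_angle {a b : Space3} {E : ℝ} (hE : 0 < E) (ha : inner ℝ a a = E)
    (hb : inner ℝ b b = E)
    (hang : InnerProductGeometry.angle (‖-a‖⁻¹ • (-a)) (‖-b‖⁻¹ • (-b)) = 2 * Real.pi / 3) :
    inner ℝ a b = -E / 2 := by
  have ha0 : a ≠ 0 := fun h => by simp [h] at ha; linarith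
  have hb0 : b ≠ 0 := fun h => by simp [h] at hb; linarith
  rw [InnerProductGeometry.angle_smul_left_of_pos _ _ (by simpa using ha0),
    InnerProductGeometry.angle_smul_right_of_pos _ _ (by simpa using hb0),
    InnerProductGeometry.angle_neg_neg] at hang
  have h1 := InnerProductGeometry.cos_angle_mul_norm_mul_norm a b
  have hcos : Real.cos (2 * Real.pi / 3) = -1 / 2 := by
    rw [show 2 * Real.pi / 3 = Real.pi - Real.pi / 3 by ring, Real.cos_pi_sub, Real.cos_pi_div_three]
    norm_num
  rw [real_inner_self_eq_norm_sq] at ha hb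
  have hab : ‖a‖ = ‖b‖ := by
    rw [← sq_eq_sq₀ (norm_nonneg a) (norm_nonneg b), ha, hb]
  rw [hang, hcos, ← hab, ← sq, ha] at h1
  rw [← h1]; ring

/-- Three conformal harmonic half disks agreeing along the diameter and meeting there at angles
of 120 degrees. -/
structure IsHarmonicY (f X Y P Q : Fin 3 → ℂ → Space3) : Prop where
  face : ∀ j, IsConformalHarmonic (f j) (X j) (Y j) (P j) (Q j)
  eqOn : ∀ i j, Set.EqOn (f i) (f j) diameterSide
  angle : ∀ z ∈ diameterSide, ∀ i j, i ≠ j → InnerProductGeometry.angle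
    (outerConormal (f i) z (-1)) (outerConormal (f j) z (-1)) = 2 * Real.pi / 3

namespace IsHarmonicY

variable {f X Y P Q : Fin 3 → ℂ → Space3} (h : IsHarmonicY f X Y P Q)
include h

theorem eqOn_Y (i j : Fin 3) : Set.EqOn (Y i) (Y j) diameterSide := by
  intro z hz
  obtain ⟨y, hy, rfl⟩ := exists_of_mem_diameterSide hz
  have hi := hasDerivWithinAt_diameter ((h.face i).hasFDerivWithinAt _ (diameterSide_subset hz))
  have hj := hasDerivWithinAt_diameter ((h.face j).hasFDerivWithinAt _ (diameterSide_subset hz))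
  exact (uniqueDiffWithinAt_diameter hy).eq_deriv _ hi
    (hj.congr_of_mem (fun t ht => h.eqOn i j (mem_diameterSide ht)) hy)

/-- Harmonicity turns `-P` into the second derivative along the diameter, which depends only on the
common boundary values. -/
theorem eqOn_P (i j : Fin 3) : Set.EqOn (P i) (P j) diameterSide := by
  intro z hz
  obtain ⟨y, hy, rfl⟩ := exists_of_mem_diameterSide hz
  have hi := hasDerivWithinAt_diameter ((h.face i).hasFDerivWithinAt_Y _ (diameterSide_subset hz))
  have hj := hasDerivWithinAt_diameter ((h.face j).hasFDerivWithinAt_Y _ (diameterSide_subset hz))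
  exact neg_injective ((uniqueDiffWithinAt_diameter hy).eq_deriv _ hi
    (hj.congr_of_mem (fun t ht => h.eqOn_Y i j (mem_diameterSide ht)) hy))

theorem inner_X_self {z : ℂ} (hz : z ∈ diameterSide) (i j : Fin 3) :
    inner ℝ (X i z) (X i z) = inner ℝ (Y j z) (Y j z) := by
  rw [(h.face i).inner_X_X z (diameterSide_subset hz), h.eqOn_Y i j hz]

theorem inner_Y_pos {z : ℂ} (hz : z ∈ diameterSide) (j : Fin 3) :
    0 < inner ℝ (Y j z) (Y j z) := by
  rw [← h.inner_X_self hz j]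
  exact (h.face j).pos z (diameterSide_subset hz)

theorem inner_X {z : ℂ} (hz : z ∈ diameterSide) {i j : Fin 3} (hij : i ≠ j) (k : Fin 3) :
    inner ℝ (X i z) (X j z) = -inner ℝ (Y k z) (Y k z) / 2 := by
  have hang := h.angle z hz i j hij
  rw [(h.face i).outerConormal_eq (diameterSide_subset hz),
    (h.face j).outerConormal_eq (diameterSide_subset hz)] at hang
  refine inner_eq_of_angle (h.inner_Y_pos hz k) (h.inner_X_self hz i k) (h.inner_X_self hz j k) ?_
  simpa using hang

/-- The squared norm of the sum is `3E - 6 (E/2) = 0`, where `E` is the common squared length. -/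
theorem sum_X {z : ℂ} (hz : z ∈ diameterSide) : X 0 z + X 1 z + X 2 z = 0 := by
  rw [← inner_self_eq_zero (𝕜 := ℝ)]
  simp only [inner_add_left, inner_add_right, h.inner_X_self hz _ 0]
  rw [h.inner_X hz (show (0 : Fin 3) ≠ 1 by decide) 0, h.inner_X hz (show (0 : Fin 3) ≠ 2 by decide) 0,
    h.inner_X hz (show (1 : Fin 3) ≠ 0 by decide) 0, h.inner_X hz (show (1 : Fin 3) ≠ 2 by decide) 0,
    h.inner_X hz (show (2 : Fin 3) ≠ 0 by decide) 0, h.inner_X hz (show (2 : Fin 3) ≠ 1 by decide) 0]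
  ring

/-- The derivative along the diameter of the constant-angle relation `inner_X`. -/
theorem inner_X_Q {z : ℂ} (hz : z ∈ diameterSide) {i j : Fin 3} (hij : i ≠ j) (k : Fin 3) :
    inner ℝ (X i z) (Q j z) + inner ℝ (Q i z) (X j z) = inner ℝ (Y k z) (P k z) := by
  obtain ⟨y, hy, rfl⟩ := exists_of_mem_diameterSide hz
  have hd := fun i => hasDerivWithinAt_diameter
    ((h.face i).hasFDerivWithinAt_X _ (diameterSide_subset hz))
  have hY := hasDerivWithinAt_diameter
    ((h.face k).hasFDerivWithinAt_Y _ (diameterSide_subset hz))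
  refine (uniqueDiffWithinAt_diameter hy).eq_deriv _ ((hd i).inner ℝ (hd j)) ?_
  refine (((hY.inner ℝ hY).neg.div_const 2).congr_of_mem
    (fun t ht => h.inner_X (mem_diameterSide ht) hij k) hy).congr_deriv ?_
  rw [inner_neg_left, inner_neg_right, real_inner_comm]
  ring

/-- Up to scale this determinant is the angular speed of the conormal about the junction curve, and
a `Y` with fixed angles turns as a whole. Algebraically, `tripleProduct_of_balanced` reduces both
sides to inner products; exchanging the two faces reverses the sign of the determinant of `X i`,
`Y`, `X j`, and the difference is the relation `inner_X_Q`. -/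
theorem tripleProduct_X_Q {z : ℂ} (hz : z ∈ diameterSide) (i j : Fin 3) :
    tripleProduct (X i z) (Y i z) (Q i z) = tripleProduct (X j z) (Y j z) (Q j z) := by
  rcases eq_or_ne i j with rfl | hij
  · rfl
  have hzD := diameterSide_subset hz
  have hE := h.inner_Y_pos hz 0
  have hXY : ∀ k l, inner ℝ (X k z) (Y l z) = 0 := fun k l => by
    rw [h.eqOn_Y l k hz]; exact (h.face k).inner_X_Y z hzD
  have hPX : ∀ k, inner ℝ (X k z) (Q k z) = -inner ℝ (Y 0 z) (P 0 z) := fun k => by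
    have := (h.face k).inner_P_Y z hzD
    rw [h.eqOn_P k 0 hz, h.eqOn_Y k 0 hz] at this
    rw [real_inner_comm, real_inner_comm (P 0 z), this, neg_neg]
  have h1 := tripleProduct_of_balanced (h.inner_X_self hz i 0) (h.inner_X_self hz j 0) rfl
    (h.inner_X hz hij 0) (hXY i 0) (hXY j 0) (Q i z)
  have h2 := tripleProduct_of_balanced (h.inner_X_self hz j 0) (h.inner_X_self hz i 0) rfl
    (h.inner_X hz hij.symm 0) (hXY j 0) (hXY i 0) (Q j z)
  have h3 := h.inner_X_Q hz hij 0
  rw [real_inner_comm] at h3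
  have h4 : tripleProduct (X j z) (Y 0 z) (X i z) = -tripleProduct (X i z) (Y 0 z) (X j z) := by
    unfold tripleProduct; ring
  rw [hPX] at h1 h2
  rw [h4] at h2
  rw [h.eqOn_Y i 0 hz, h.eqOn_Y j 0 hz]
  refine mul_left_cancel₀ (mul_pos three_pos hE).ne' ?_
  have h5 := real_inner_comm (X j z) (Q i z)
  have h6 := real_inner_comm (X i z) (Q j z)
  rw [h5, h6] at h3
  rw [h1, h2]
  linear_combination 4 * tripleProduct (X i z) (Y 0 z) (X j z) * h3

/-- The determinant is linear in `X`, while `Y` and `P` are common to the faces and the `X j` sum to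
zero. -/
theorem sum_tripleProduct_X_P {z : ℂ} (hz : z ∈ diameterSide) :
    tripleProduct (X 0 z) (Y 0 z) (P 0 z) + tripleProduct (X 1 z) (Y 1 z) (P 1 z) +
      tripleProduct (X 2 z) (Y 2 z) (P 2 z) = 0 := by
  have e := fun k : Fin 3 => congrArg (fun w : Space3 => w k) (h.sum_X hz)
  simp only [PiLp.add_apply, PiLp.zero_apply] at e
  rw [h.eqOn_Y 1 0 hz, h.eqOn_Y 2 0 hz, h.eqOn_P 1 0 hz, h.eqOn_P 2 0 hz]
  unfold tripleProduct
  linear_combination (Y 0 z 2 * P 0 z 1 * (-1) + Y 0 z 1 * P 0 z 2) * e 0 +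
    (Y 0 z 2 * P 0 z 0 - Y 0 z 0 * P 0 z 2) * e 1 + (Y 0 z 0 * P 0 z 1 - Y 0 z 1 * P 0 z 0) * e 2

theorem hopf_re_im {z : ℂ} (hz : z ∈ diameterSide) (i : Fin 3) :
    (hopf (X i) (Y i) (P i) (Q i) z).re =
        tripleProduct (X i z) (Y i z) (P i z) / inner ℝ (Y 0 z) (Y 0 z) ∧
      (hopf (X i) (Y i) (P i) (Q i) z).im =
        -tripleProduct (X i z) (Y i z) (Q i z) / inner ℝ (Y 0 z) (Y 0 z) := by
  rw [hopf, h.inner_X_self hz i 0, Complex.div_ofReal_re, Complex.div_ofReal_im]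
  simp

/-- The Hopf differentials of the faces of a free boundary `Y` in the unit ball vanish. -/
theorem hopf_eq_zero (hnorm : ∀ j, ∀ z ∈ arcSide, ‖f j z‖ = 1)
    (horth : ∀ j, ∀ z ∈ arcSide, outerConormal (f j) z z ∈ Submodule.span ℝ {f j z})
    (j : Fin 3) : ∀ z ∈ halfDisk, hopf (X j) (Y j) (P j) (Q j) z = 0 := by
  -- The factor `z²` makes the function real on the arc, is itself real on the diameter, and
  -- vanishes at `0`, a point where every constant obtained below can be evaluated.
  set H : Fin 3 → ℂ → ℂ := fun i z => z ^ 2 * hopf (X i) (Y i) (P i) (Q i) z with hH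
  have h0 : (0 : ℂ) ∈ halfDisk := by simp [halfDisk]
  have hc : ∀ i, ContinuousOn (H i) halfDisk := fun i =>
    (continuousOn_pow 2).mul (h.face i).continuousOn_hopf
  have hd : ∀ i, DifferentiableOn ℂ (H i) (interior halfDisk) := fun i =>
    (differentiableOn_pow 2).mul (h.face i).differentiableOn_hopf
  have harc : ∀ i, ∀ z ∈ arcSide, (H i z).im = 0 := fun i =>
    (h.face i).im_sq_mul_hopf_arc (hnorm i) (horth i)
  have hre : ∀ i, ∀ z ∈ diameterSide, (H i z).re =
      -(z.im ^ 2) * (hopf (X i) (Y i) (P i) (Q i) z).re := by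
    intro i z hz; simp [hH, sq, hz.1]
  have him : ∀ i, ∀ z ∈ diameterSide, (H i z).im =
      -(z.im ^ 2) * (hopf (X i) (Y i) (P i) (Q i) z).im := by
    intro i z hz; simp [hH, sq, hz.1]
  have heq : ∀ i, ∀ z ∈ halfDisk, H i z = H j z := by
    intro i z hz
    obtain ⟨c, hcst⟩ := eq_const_of_real_on_boundary ((hc i).sub (hc j)) ((hd i).sub (hd j))
      (fun z hz => by
        rw [Pi.sub_apply, Complex.sub_im, him i z hz, him j z hz, (h.hopf_re_im hz i).2,
          (h.hopf_re_im hz j).2, h.tripleProduct_X_Q hz i j, sub_self])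
      (fun z hz => by rw [Pi.sub_apply, Complex.sub_im, harc i z hz, harc j z hz, sub_self])
    have e := (hcst z hz).trans (hcst 0 h0).symm
    exact sub_eq_zero.1 (e.trans (by simp [hH]))
  have hre0 : ∀ z ∈ diameterSide, (H j z).re = 0 := by
    intro z hz
    have hzD := diameterSide_subset hz
    have hs : (H 0 z).re + (H 1 z).re + (H 2 z).re = 0 := by
      rw [hre 0 z hz, hre 1 z hz, hre 2 z hz, (h.hopf_re_im hz 0).1, (h.hopf_re_im hz 1).1,
        (h.hopf_re_im hz 2).1, ← mul_add, ← mul_add, ← add_div, ← add_div,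
        h.sum_tripleProduct_X_P hz, zero_div, mul_zero]
    rw [heq 0 z hzD, heq 1 z hzD, heq 2 z hzD] at hs
    linarith
  -- `H j` is imaginary on the diameter and real on the arc, so its square is real on both.
  obtain ⟨c, hcst⟩ := eq_const_of_real_on_boundary ((hc j).mul (hc j)) ((hd j).mul (hd j))
    (fun z hz => by simp [hre0 z hz]) (fun z hz => by simp [harc j z hz])
  have hzero : ∀ z ∈ halfDisk, H j z = 0 := by
    intro z hz
    have e := (hcst z hz).trans (hcst 0 h0).symm
    simpa [hH] using e
  have hint : ∀ z ∈ interior halfDisk, hopf (X j) (Y j) (P j) (Q j) z = 0 := by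
    intro z hz
    have hz0 : z ≠ 0 := by
      rintro rfl; simpa using (mem_interior_halfDisk.1 hz).2
    exact (mul_eq_zero.1 (hzero z (interior_subset hz))).resolve_left (pow_ne_zero 2 hz0)
  have := Set.EqOn.of_subset_closure (g := fun _ => (0 : ℂ)) hint
    (by rw [closure_interior_halfDisk]; exact (h.face j).continuousOn_hopf)
    continuousOn_const subset_closure subset_rfl
  rwa [closure_interior_halfDisk] at this

end IsHarmonicY

/-! ### Vanishing Hopf differential: planar faces -/

section Planar

variable {f X Y P Q : ℂ → Space3}

theorem IsConformalHarmonic.wedge_deriv_eq (h : IsConformalHarmonic f X Y P Q)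
    (h0 : ∀ z ∈ halfDisk, hopf X Y P Q z = 0) {z : ℂ} (hz : z ∈ halfDisk) (k l : Fin 3) :
    complexPair (X z) (Y z) k * complexPair (P z) (Q z) l =
      complexPair (X z) (Y z) l * complexPair (P z) (Q z) k := by
  have key := fun k => h.hopf_mul hz k
  simp only [h0 z hz, zero_mul, zero_eq_mul, Complex.I_ne_zero, false_or, sub_eq_zero] at key
  have e0 := key 0
  have e1 := key 1
  have e2 := key 2
  simp only [zero_add, show (1 : Fin 3) + 1 = 2 from rfl, show (2 : Fin 3) + 1 = 0 from rfl,
    show (1 : Fin 3) + 2 = 0 from rfl, show (2 : Fin 3) + 2 = 1 from rfl] at e0 e1 e2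
  fin_cases k <;> fin_cases l <;> first | rfl | assumption | (symm; assumption)

/-- A conformal harmonic map with vanishing Hopf differential has parallel complex gradients. -/
theorem IsConformalHarmonic.wedge_eq (h : IsConformalHarmonic f X Y P Q)
    (h0 : ∀ z ∈ halfDisk, hopf X Y P Q z = 0) {z w : ℂ} (hz : z ∈ halfDisk) (hw : w ∈ halfDisk)
    (k l : Fin 3) :
    complexPair (X z) (Y z) k * complexPair (X w) (Y w) l =
      complexPair (X z) (Y z) l * complexPair (X w) (Y w) k := by
  set F : Fin 3 → ℂ → ℂ := fun k z => complexPair (X z) (Y z) k with hF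
  have hdF : ∀ k, DifferentiableOn ℂ (F k) (interior halfDisk) := h.differentiableOn_complexPair
  have hcF : ∀ k, ContinuousOn (F k) halfDisk := fun k z hz =>
    (h.hasDerivWithinAt_complexPair hz k).continuousWithinAt
  set p : ℂ := 1 / 2 with hp
  have hpi : p ∈ interior halfDisk := half_mem_interior_halfDisk
  obtain ⟨m, hm⟩ := h.exists_complexPair_ne_zero (interior_subset hpi)
  have hFm : ContinuousAt (F m) p :=
    ((hdF m).differentiableAt (isOpen_interior.mem_nhds hpi)).continuousAt
  have hnear : ∀ᶠ z in nhds p, z ∈ interior halfDisk ∧ F m z ≠ 0 :=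
    (isOpen_interior.eventually_mem hpi).and (hFm.eventually_ne hm)
  obtain ⟨ε, hε, hball⟩ := Metric.eventually_nhds_iff_ball.1 hnear
  -- Near `p` the component `F m` has no zero, and the quotients `F l / F m` have zero derivative
  -- because `F` and `F'` are parallel.
  have hloc : ∀ l, ∀ z ∈ Metric.ball p ε, F l z * F m p = F l p * F m z := by
    intro l z hz
    have hder : ∀ z ∈ Metric.ball p ε, HasDerivAt (F l / F m) 0 z := by
      intro z hz
      obtain ⟨hzi, hne⟩ := hball z hz
      refine ((h.hasDerivAt_complexPair hzi l).div (h.hasDerivAt_complexPair hzi m) hne).congr_deriv ?_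
      rw [mul_comm, h.wedge_deriv_eq h0 (interior_subset hzi) m l, sub_self, zero_div]
    obtain ⟨c, hc⟩ := Metric.isOpen_ball.exists_is_const_of_deriv_eq_zero
      (convex_ball p ε).isPreconnected
      (fun z hz => (hder z hz).differentiableAt.differentiableWithinAt)
      (fun z hz => (hder z hz).deriv)
    have e1 := hc z hz
    have e2 := hc p (Metric.mem_ball_self hε)
    have e3 := e1.trans e2.symm
    rwa [Pi.div_apply, Pi.div_apply, div_eq_div_iff (hball z hz).2 hm] at e3
  -- `F m` may vanish away from `p`, so the relation is cleared of denominators and extended by the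
  -- identity theorem, then by continuity to the boundary.
  have hall : ∀ l, ∀ z ∈ halfDisk, F l z * F m p = F l p * F m z := by
    intro l
    have h1 : Set.EqOn (fun z => F l z * F m p) (fun z => F l p * F m z) (interior halfDisk) := by
      refine AnalyticOnNhd.eqOn_of_preconnected_of_eventuallyEq
        (((hdF l).mul_const _).analyticOnNhd isOpen_interior)
        (((hdF m).const_mul _).analyticOnNhd isOpen_interior)
        convex_halfDisk.interior.isPreconnected hpi ?_
      exact Filter.eventually_of_mem (Metric.ball_mem_nhds p hε) (hloc l)
    have h2 := h1.of_subset_closure (t := halfDisk) ((hcF l).mul continuousOn_const)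
      (continuousOn_const.mul (hcF m)) interior_subset closure_interior_halfDisk.ge
    exact h2
  have hne : F m p * F m p ≠ 0 := mul_ne_zero hm hm
  refine mul_right_cancel₀ hne ?_
  have a1 := hall k z hz
  have a2 := hall l z hz
  have a3 := hall k w hw
  have a4 := hall l w hw
  change F k z * F l w * _ = F l z * F k w * _
  calc F k z * F l w * (F m p * F m p) = (F k z * F m p) * (F l w * F m p) := by ring
    _ = (F l z * F m p) * (F k w * F m p) := by rw [a1, a2, a3, a4]; ring
    _ = _ := by ring

/-- A conformal harmonic map with vanishing Hopf differential whose gradient at the origin is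
`L a`, `L e`, with `a`, `e` orthonormal, has all its gradients in the span of `a` and `e`. -/
theorem IsConformalHarmonic.partials_eq (h : IsConformalHarmonic f X Y P Q)
    (h0 : ∀ z ∈ halfDisk, hopf X Y P Q z = 0) {a e : Space3} {L : ℝ} (hL : L ≠ 0)
    (ha : inner ℝ a a = 1) (hae : inner ℝ a e = 0) (hX : X 0 = L • a) (hY : Y 0 = L • e)
    {z : ℂ} (hz : z ∈ halfDisk) :
    X z = inner ℝ (X z) a • a - inner ℝ (Y z) a • e ∧
      Y z = inner ℝ (Y z) a • a + inner ℝ (X z) a • e := by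
  have h00 : (0 : ℂ) ∈ halfDisk := by simp [halfDisk]
  have hpair : ∀ k, complexPair (X 0) (Y 0) k = L * ((a k : ℂ) - Complex.I * (e k : ℂ)) := by
    intro k; rw [hX, hY]; simp [complexPair]; ring
  have hL' : (L : ℂ) ≠ 0 := by exact_mod_cast hL
  have hw : ∀ k l, complexPair (X z) (Y z) k * ((a l : ℂ) - Complex.I * (e l : ℂ)) =
      complexPair (X z) (Y z) l * ((a k : ℂ) - Complex.I * (e k : ℂ)) := by
    intro k l
    have := h.wedge_eq h0 hz h00 k l
    rw [hpair, hpair] at this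
    refine mul_left_cancel₀ hL' ?_
    linear_combination this
  rw [space3_inner] at ha hae
  have ha' : (a 0 * a 0 + a 1 * a 1 + a 2 * a 2 : ℂ) = 1 := by exact_mod_cast ha
  have hae' : (a 0 * e 0 + a 1 * e 1 + a 2 * e 2 : ℂ) = 0 := by exact_mod_cast hae
  -- Contraction of `hw` with `a`, using `(a - ie)·a = 1`.
  have key : ∀ k, complexPair (X z) (Y z) k =
      ((inner ℝ (X z) a : ℝ) - Complex.I * (inner ℝ (Y z) a : ℝ)) *
        ((a k : ℂ) - Complex.I * (e k : ℂ)) := by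
    intro k
    have e0 := hw k 0
    have e1 := hw k 1
    have e2 := hw k 2
    have hr : ((inner ℝ (X z) a : ℝ) - Complex.I * (inner ℝ (Y z) a : ℝ) : ℂ) =
        complexPair (X z) (Y z) 0 * a 0 + complexPair (X z) (Y z) 1 * a 1 +
          complexPair (X z) (Y z) 2 * a 2 := by
      rw [space3_inner, space3_inner]; simp only [complexPair]; push_cast; ring
    rw [hr]
    linear_combination (a 0 : ℂ) * e0 + (a 1 : ℂ) * e1 + (a 2 : ℂ) * e2 -
      complexPair (X z) (Y z) k * ha' + Complex.I * complexPair (X z) (Y z) k * hae'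
  constructor
  · ext k
    simpa [complexPair] using congrArg Complex.re (key k)
  · ext k
    have := congrArg Complex.im (key k)
    simp [complexPair] at this
    simp
    linarith

/-- The coordinate of a map in the plane spanned by two vectors. -/
noncomputable def planeCoord (a e : Space3) (f : ℂ → Space3) (z : ℂ) : ℂ :=
  (inner ℝ (f z) a : ℝ) + (inner ℝ (f z) e : ℝ) * Complex.I

/-- The complex derivative of `planeCoord`. -/
noncomputable def planeCoordDeriv (a : Space3) (X Y : ℂ → Space3) (z : ℂ) : ℂ :=
  (inner ℝ (X z) a : ℝ) - (inner ℝ (Y z) a : ℝ) * Complex.I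

theorem IsConformalHarmonic.hasDerivWithinAt_planeCoord (h : IsConformalHarmonic f X Y P Q)
    {a e : Space3} {z : ℂ} (hz : z ∈ halfDisk) (he : inner ℝ e e = 1)
    (hae : inner ℝ a e = 0)
    (hX : X z = inner ℝ (X z) a • a - inner ℝ (Y z) a • e)
    (hY : Y z = inner ℝ (Y z) a • a + inner ℝ (X z) a • e) :
    HasDerivWithinAt (planeCoord a e f) (planeCoordDeriv a X Y z) halfDisk z := by
  have hd := h.hasFDerivWithinAt z hz
  have h1 := Complex.ofRealCLM.hasFDerivAt.comp_hasFDerivWithinAt z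
    (hd.inner ℝ (hasFDerivWithinAt_const a z halfDisk))
  have h2 := Complex.ofRealCLM.hasFDerivAt.comp_hasFDerivWithinAt z
    (hd.inner ℝ (hasFDerivWithinAt_const e z halfDisk))
  have h3 := h1.add (h2.mul_const Complex.I)
  have hXe : inner ℝ (X z) e = -inner ℝ (Y z) a := by
    conv_lhs => rw [hX]
    rw [inner_sub_left, real_inner_smul_left, real_inner_smul_left, hae, he]; ring
  have hYe : inner ℝ (Y z) e = inner ℝ (X z) a := by
    conv_lhs => rw [hY]
    rw [inner_add_left, real_inner_smul_left, real_inner_smul_left, hae, he]; ring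
  have h4 := hasDerivWithinAt_of_hasFDerivWithinAt_real h3 (by
    apply Complex.ext <;> simp [hXe, hYe])
  refine h4.congr_deriv ?_
  simp [planeCoordDeriv, hXe]
  ring

theorem inner_smul_add_smul_self {a e : Space3} (ha : inner ℝ a a = 1) (he : inner ℝ e e = 1)
    (hae : inner ℝ a e = 0) (x y : ℝ) :
    inner ℝ (x • a + y • e) a = x ∧ inner ℝ (x • a + y • e) e = y := by
  have hea : inner ℝ e a = 0 := by rw [real_inner_comm, hae]
  simp only [inner_add_left, real_inner_smul_left, ha, he, hae, hea]
  constructor <;> ring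

/-- A conformal harmonic map whose gradients lie in the span of `a` and `e`, orthogonal to the unit
sphere along the half circle, takes values in the plane spanned by `a` and `e`. -/
theorem IsConformalHarmonic.eq_planeCoord (h : IsConformalHarmonic f X Y P Q)
    {a e : Space3} (ha : inner ℝ a a = 1) (he : inner ℝ e e = 1) (hae : inner ℝ a e = 0)
    (hXY : ∀ z ∈ halfDisk, X z = inner ℝ (X z) a • a - inner ℝ (Y z) a • e ∧
      Y z = inner ℝ (Y z) a • a + inner ℝ (X z) a • e)
    (horth : ∀ z ∈ arcSide, outerConormal f z z ∈ Submodule.span ℝ {f z}) {z : ℂ}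
    (hz : z ∈ halfDisk) :
    f z = (planeCoord a e f z).re • a + (planeCoord a e f z).im • e := by
  have hspan : ∀ x y : ℝ, ∀ v : Space3, v = x • a + y • e →
      v - inner ℝ v a • a - inner ℝ v e • e = 0 := by
    rintro x y v rfl
    rw [(inner_smul_add_smul_self ha he hae x y).1, (inner_smul_add_smul_self ha he hae x y).2]
    abel
  have hX0 : ∀ z ∈ halfDisk, X z - inner ℝ (X z) a • a - inner ℝ (X z) e • e = 0 := fun z hz =>
    hspan (inner ℝ (X z) a) (-inner ℝ (Y z) a) _ (by rw [neg_smul, ← sub_eq_add_neg]; exact (hXY z hz).1)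
  have hY0 : ∀ z ∈ halfDisk, Y z - inner ℝ (Y z) a • a - inner ℝ (Y z) e • e = 0 := fun z hz =>
    hspan _ _ _ (hXY z hz).2
  -- The component of `f` normal to the plane. Its gradient vanishes, so it is constant; at the
  -- point `1` of the arc `f` is a multiple of `X`, hence the constant is zero.
  set r : ℂ → Space3 := fun z => f z - inner ℝ (f z) a • a - inner ℝ (f z) e • e with hr
  have hder : ∀ z ∈ halfDisk, HasFDerivWithinAt r (0 : ℂ →L[ℝ] Space3) halfDisk z := by
    intro z hz
    have hd := h.hasFDerivWithinAt z hz
    have h1 := (hd.inner ℝ (hasFDerivWithinAt_const a z halfDisk)).smul_const a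
    have h2 := (hd.inner ℝ (hasFDerivWithinAt_const e z halfDisk)).smul_const e
    refine ((hd.sub h1).sub h2).congr_fderiv ?_
    refine (eq_planarDeriv _).trans ?_
    have e1 := hX0 z hz
    have e2 := hY0 z hz
    ext w : 1
    simp
    rw [e1, e2]
    simp
  have h1 : (1 : ℂ) ∈ arcSide := by simp [arcSide]
  have hconst : r z = r 1 := convex_halfDisk.is_const_of_fderivWithin_eq_zero
    (fun z hz => (hder z hz).differentiableWithinAt)
    (fun z hz => (hder z hz).fderivWithin (uniqueDiffOn_halfDisk z hz)) hz (arcSide_subset h1)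
  obtain ⟨m, hm0, hm⟩ := h.radial_eq_smul h1 (horth 1 h1)
  have hf1 : f 1 = m⁻¹ • X 1 := by
    have : X 1 = m • f 1 := by simpa using hm
    rw [this, inv_smul_smul₀ hm0]
  have hr1 : r 1 = 0 := by
    have hX1 := hX0 1 (arcSide_subset h1)
    have : r 1 = m⁻¹ • (X 1 - inner ℝ (X 1) a • a - inner ℝ (X 1) e • e) := by
      simp only [hr, hf1, real_inner_smul_left, smul_sub, mul_smul]
    rw [this, hX1, smul_zero]
  rw [hr1] at hconst
  have : f z - inner ℝ (f z) a • a - inner ℝ (f z) e • e = 0 := hconst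
  rw [sub_sub, sub_eq_zero] at this
  simpa [planeCoord] using this

end Planar

/-! ### Rigidity of holomorphic half disks -/

/-- A holomorphic immersion of the half disk into the unit disk, smooth up to the boundary, which
maps the half circle into the unit circle, orthogonally, and the diameter into the imaginary
axis, pointing to the right there. -/
structure IsHalfDiskImmersion (g ρ : ℂ → ℂ) : Prop where
  hasDerivWithinAt : ∀ z ∈ halfDisk, HasDerivWithinAt g (ρ z) halfDisk z
  continuousOn_deriv : ContinuousOn ρ halfDisk
  deriv_ne_zero : ∀ z ∈ halfDisk, ρ z ≠ 0
  re_eq_zero : ∀ z ∈ diameterSide, (g z).re = 0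
  norm_eq_one : ∀ z ∈ arcSide, ‖g z‖ = 1
  radial : ∀ z ∈ arcSide, ∃ m : ℝ, z * ρ z = m * g z
  re_deriv_pos : 0 < (ρ 0).re
  norm_le_one : ∀ z ∈ halfDisk, ‖g z‖ ≤ 1

namespace IsHalfDiskImmersion

variable {g ρ : ℂ → ℂ} (h : IsHalfDiskImmersion g ρ)
include h

theorem hasDerivWithinAt_diameter {y : ℝ} (hy : y ∈ Set.Icc (-1 : ℝ) 1) :
    HasDerivWithinAt (fun t : ℝ => g (t * Complex.I)) (ρ (y * Complex.I) * Complex.I)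
      (Set.Icc (-1) 1) y := by
  refine _root_.hasDerivWithinAt_diameter (a := ρ (y * Complex.I)) ?_
  refine ((h.hasDerivWithinAt _ (diameterSide_subset
    (mem_diameterSide hy))).hasFDerivWithinAt.restrictScalars ℝ).congr_fderiv ?_
  refine (eq_planarDeriv _).trans ?_
  simp [mul_comm]

theorem im_deriv_diameter {z : ℂ} (hz : z ∈ diameterSide) : (ρ z).im = 0 := by
  obtain ⟨y, hy, rfl⟩ := exists_of_mem_diameterSide hz
  have h1 := Complex.reCLM.hasFDerivAt.comp_hasDerivWithinAt y (h.hasDerivWithinAt_diameter hy)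
  have h2 := (uniqueDiffWithinAt_diameter hy).eq_deriv _ h1
    ((hasDerivWithinAt_const y (Set.Icc (-1 : ℝ) 1) (0 : ℝ)).congr_of_mem
      (fun t ht => h.re_eq_zero _ (mem_diameterSide ht)) hy)
  simpa using h2

/-- On the diameter `ρ` is real and has no zero, so it keeps the sign it has at the origin. -/
theorem re_deriv_pos_diameter {y : ℝ} (hy : y ∈ Set.Icc (-1 : ℝ) 1) :
    0 < (ρ (y * Complex.I)).re := by
  have hc : ContinuousOn (fun t : ℝ => (ρ (t * Complex.I)).re) (Set.Icc (-1) 1) :=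
    Complex.continuous_re.comp_continuousOn (h.continuousOn_deriv.comp (by fun_prop)
      fun t ht => diameterSide_subset (mem_diameterSide ht))
  by_contra! hneg
  obtain ⟨t, ht, ht0⟩ := isPreconnected_Icc.intermediate_value hy
    (show (0 : ℝ) ∈ Set.Icc (-1 : ℝ) 1 by norm_num) hc
    (show (0 : ℝ) ∈ Set.Icc _ _ from ⟨hneg, by simpa using h.re_deriv_pos.le⟩)
  exact h.deriv_ne_zero _ (diameterSide_subset (mem_diameterSide ht))
    (Complex.ext ht0 (h.im_deriv_diameter (mem_diameterSide ht)))

theorem strictMonoOn_im : StrictMonoOn (fun t : ℝ => (g (t * Complex.I)).im) (Set.Icc (-1) 1) := by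
  have hd : ∀ y ∈ Set.Icc (-1 : ℝ) 1, HasDerivWithinAt (fun t : ℝ => (g (t * Complex.I)).im)
      (ρ (y * Complex.I)).re (Set.Icc (-1) 1) y := fun y hy =>
    (Complex.imCLM.hasFDerivAt.comp_hasDerivWithinAt y
      (h.hasDerivWithinAt_diameter hy)).congr_deriv (by simp)
  refine strictMonoOn_of_deriv_pos (convex_Icc _ _)
    (fun y hy => (hd y hy).continuousWithinAt) fun y hy => ?_
  have hy' := interior_subset hy
  rw [((hd y hy').hasDerivAt (mem_interior_iff_mem_nhds.1 hy)).deriv]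
  exact h.re_deriv_pos_diameter hy'

/-- The corners lie on both sides of the half disk, so their images are imaginary of norm 1, and
monotonicity along the diameter decides which is which. -/
theorem corner_values : g Complex.I = Complex.I ∧ g (-Complex.I) = -Complex.I := by
  have hI : Complex.I ∈ arcSide := by simp [arcSide]
  have hI' : -Complex.I ∈ arcSide := by simp [arcSide]
  have hre : (g Complex.I).re = 0 := h.re_eq_zero _ (by simp [diameterSide])
  have hre' : (g (-Complex.I)).re = 0 := h.re_eq_zero _ (by simp [diameterSide])
  have hm := h.strictMonoOn_im (show (-1 : ℝ) ∈ Set.Icc (-1 : ℝ) 1 by norm_num)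
    (show (1 : ℝ) ∈ Set.Icc (-1 : ℝ) 1 by norm_num) (by norm_num)
  have habs : ∀ w : ℂ, ‖w‖ = 1 → w.re = 0 → w.im = 1 ∨ w.im = -1 := by
    intro w hw hw0
    have := Complex.sq_norm w
    rw [hw, Complex.normSq_apply, hw0] at this
    exact mul_self_eq_one_iff.1 (by linarith)
  have h1 := habs _ (h.norm_eq_one _ hI) hre
  have h2 := habs _ (h.norm_eq_one _ hI') hre'
  simp at hm
  refine ⟨Complex.ext (by simpa using hre) ?_, Complex.ext (by simpa using hre') ?_⟩
  · rcases h1 with h1 | h1 <;> rcases h2 with h2 | h2 <;> rw [h1, h2] at hm <;>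
      first | (norm_num at hm; done) | simpa using h1
  · rcases h1 with h1 | h1 <;> rcases h2 with h2 | h2 <;> rw [h1, h2] at hm <;>
      first | (norm_num at hm; done) | simpa using h2

theorem differentiableOn : DifferentiableOn ℂ g (interior halfDisk) := fun z hz =>
  (h.hasDerivWithinAt z (interior_subset hz)).differentiableWithinAt.mono interior_subset

theorem hasDerivAt {z : ℂ} (hz : z ∈ interior halfDisk) : HasDerivAt g (ρ z) z :=
  (h.hasDerivWithinAt z (interior_subset hz)).hasDerivAt (mem_interior_iff_mem_nhds.1 hz)

theorem continuousOn : ContinuousOn g halfDisk := fun z hz =>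
  (h.hasDerivWithinAt z hz).continuousWithinAt

theorem differentiableOn_deriv : DifferentiableOn ℂ ρ (interior halfDisk) :=
  (h.differentiableOn.deriv isOpen_interior).congr fun _ hz => (h.hasDerivAt hz).deriv.symm

/-- Since `c² = -1`, numerator and denominator factor through `g w - c` and `w - c`. The difference
quotient tends to `ρ c`, which cancels the derivative in the denominator. -/
theorem tendsto_ratio {c : ℂ} (hc : c ∈ halfDisk) (hc2 : c ^ 2 = -1) (hgc : g c = c) :
    Filter.Tendsto (fun w => (1 + g w ^ 2) / (ρ w * (1 + w ^ 2))) (nhdsWithin c (halfDisk \ {c}))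
      (nhds 1) := by
  have hc0 : c ≠ 0 := by rintro rfl; norm_num at hc2
  have hmono : nhdsWithin c (halfDisk \ {c}) ≤ nhdsWithin c halfDisk :=
    nhdsWithin_mono _ Set.sdiff_subset
  have h1 : Filter.Tendsto (slope g c) (nhdsWithin c (halfDisk \ {c})) (nhds (ρ c)) :=
    hasDerivWithinAt_iff_tendsto_slope.1 (h.hasDerivWithinAt c hc)
  have hg : Filter.Tendsto g (nhdsWithin c (halfDisk \ {c})) (nhds (g c)) :=
    (h.continuousOn c hc).mono_left hmono
  have hρ : Filter.Tendsto ρ (nhdsWithin c (halfDisk \ {c})) (nhds (ρ c)) :=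
    (h.continuousOn_deriv c hc).mono_left hmono
  have hw : Filter.Tendsto (fun w : ℂ => w) (nhdsWithin c (halfDisk \ {c})) (nhds c) :=
    Filter.tendsto_id.mono_left nhdsWithin_le_nhds
  have hcc : c + c ≠ 0 := by rw [← two_mul]; exact mul_ne_zero two_ne_zero hc0
  have hlim := (h1.mul ((hg.add_const c).div (hw.add_const c) hcc)).div hρ (h.deriv_ne_zero c hc)
  rw [hgc, div_self hcc, mul_one, div_self (h.deriv_ne_zero c hc)] at hlim
  refine hlim.congr' ?_
  have hne : ∀ᶠ w in nhdsWithin c (halfDisk \ {c}), w + c ≠ 0 :=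
    (hw.add_const c).eventually_ne hcc
  filter_upwards [hne, self_mem_nhdsWithin] with w hw1 hw2
  have hw3 : w - c ≠ 0 := sub_ne_zero.2 hw2.2
  have hw4 := h.deriv_ne_zero w hw2.1
  have e1 : 1 + w ^ 2 = (w - c) * (w + c) := by linear_combination hc2
  have e2 : 1 + g w ^ 2 = (g w - c) * (g w + c) := by linear_combination hc2
  rw [e1, e2]
  simp only [Pi.div_apply, slope_def_field, hgc]
  field_simp

/-- This is the differential equation `g' / (1 + g²) = 1 / (1 + z²)`. The quotient of its sides is
real on the diameter, where `g` and `z` are imaginary and `ρ` is real. On the arc it is real because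
`1 + v² = 2 v Re v` for unit `v` and `z ρ = m g`. So it is constant, with value 1 at a corner. -/
theorem one_add_sq_eq {z : ℂ} (hz : z ∈ interior halfDisk) : 1 + g z ^ 2 = ρ z * (1 + z ^ 2) := by
  classical
  set K : ℂ → ℂ := fun w => if w ^ 2 = -1 then 1 else (1 + g w ^ 2) / (ρ w * (1 + w ^ 2)) with hK
  have hsq : ∀ w : ℂ, w ^ 2 = -1 ↔ w = Complex.I ∨ w = -Complex.I := fun w => by
    rw [← Complex.I_sq, sq_eq_sq_iff_eq_or_eq_neg]
  have hden : ∀ w ∈ halfDisk, w ^ 2 ≠ -1 → ρ w * (1 + w ^ 2) ≠ 0 := fun w hw hw2 =>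
    mul_ne_zero (h.deriv_ne_zero w hw) fun h0 => hw2 (by linear_combination h0)
  have hKev : ∀ c : ℂ, c ^ 2 ≠ -1 → K =ᶠ[nhds c] fun w => (1 + g w ^ 2) / (ρ w * (1 + w ^ 2)) := by
    intro c hc
    filter_upwards [(continuous_pow 2).continuousAt.eventually_ne hc] with w hw
    exact if_neg hw
  have hint : ∀ w ∈ interior halfDisk, w ^ 2 ≠ -1 := by
    intro w hw hw2
    have h2 := (mem_interior_halfDisk.1 hw).2
    rcases (hsq w).1 hw2 with rfl | rfl <;> simp at h2
  have hKc : ContinuousOn K halfDisk := by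
    intro c hc
    by_cases hc2 : c ^ 2 = -1
    · have hgc : g c = c := by
        rcases (hsq c).1 hc2 with rfl | rfl
        exacts [h.corner_values.1, h.corner_values.2]
      rw [← continuousWithinAt_sdiff_self, ContinuousWithinAt, show K c = 1 from if_pos hc2]
      refine (h.tendsto_ratio hc hc2 hgc).congr' ?_
      have hne : ∀ᶠ w in nhdsWithin c (halfDisk \ {c}), w + c ≠ 0 := by
        refine Filter.Eventually.filter_mono nhdsWithin_le_nhds
          ((continuousAt_id.add continuousAt_const).eventually_ne ?_)
        change c + c ≠ 0
        rw [← two_mul]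
        refine mul_ne_zero two_ne_zero ?_
        rintro rfl; norm_num at hc2
      filter_upwards [hne, self_mem_nhdsWithin] with w hw1 hw2
      refine (if_neg fun hw3 => ?_).symm
      rw [← hc2, sq_eq_sq_iff_eq_or_eq_neg] at hw3
      rcases hw3 with hw3 | hw3
      · exact hw2.2 hw3
      · exact hw1 (by rw [hw3]; ring)
    · refine ContinuousWithinAt.congr_of_eventuallyEq ?_
        ((hKev c hc2).filter_mono nhdsWithin_le_nhds) (if_neg hc2)
      have hgc := h.continuousOn c hc
      have hρc := h.continuousOn_deriv c hc
      exact (continuousWithinAt_const.add (hgc.pow 2)).div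
        (hρc.mul (by fun_prop)) (hden c hc hc2)
  have hKd : DifferentiableOn ℂ K (interior halfDisk) := by
    have : DifferentiableOn ℂ (fun w => (1 + g w ^ 2) / (ρ w * (1 + w ^ 2))) (interior halfDisk) :=
      ((differentiableOn_const 1).add (h.differentiableOn.pow 2)).div
        (h.differentiableOn_deriv.mul (by fun_prop))
        fun w hw => hden w (interior_subset hw) (hint w hw)
    exact this.congr fun w hw => if_neg (hint w hw)
  obtain ⟨c, hcst⟩ := eq_const_of_real_on_boundary hKc hKd
    (fun w hw => by
      by_cases hw2 : w ^ 2 = -1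
      · simp [hK, hw2]
      · have e1 : w = (w.im : ℂ) * Complex.I := Complex.ext (by simp [hw.1]) (by simp)
        have e2 : g w = ((g w).im : ℂ) * Complex.I :=
          Complex.ext (by simp [h.re_eq_zero w hw]) (by simp)
        have e3 : ρ w = ((ρ w).re : ℂ) :=
          Complex.ext (by simp) (by simp [h.im_deriv_diameter hw])
        have e4 : K w = (((1 - (g w).im ^ 2) / ((ρ w).re * (1 - w.im ^ 2)) : ℝ) : ℂ) := by
          rw [hK]
          simp only [if_neg hw2]
          have e5 : 1 + w ^ 2 = ((1 - w.im ^ 2 : ℝ) : ℂ) := by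
            conv_lhs => rw [e1]
            rw [mul_pow, Complex.I_sq]; push_cast; ring
          have e6 : 1 + g w ^ 2 = ((1 - (g w).im ^ 2 : ℝ) : ℂ) := by
            conv_lhs => rw [e2]
            rw [mul_pow, Complex.I_sq]; push_cast; ring
          rw [e5, e6]
          conv_lhs => rw [e3]
          norm_cast
        rw [e4, Complex.ofReal_im])
    (fun w hw => by
      by_cases hw2 : w ^ 2 = -1
      · simp [hK, hw2]
      · obtain ⟨m, hm⟩ := h.radial w hw
        have hw0 := ne_zero_of_mem_arcSide hw
        have hunit : ∀ v : ℂ, ‖v‖ = 1 → 1 + v ^ 2 = v * ((2 * v.re : ℝ) : ℂ) := by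
          intro v hv
          have h1 : v * (starRingEnd ℂ) v = 1 := by
            rw [Complex.mul_conj, Complex.normSq_eq_norm_sq, hv]; norm_num
          rw [← Complex.add_conj]
          linear_combination -h1
        have hwn : ‖w‖ = 1 := by
          rw [← sq_eq_sq₀ (norm_nonneg w) zero_le_one, Complex.sq_norm, Complex.normSq_apply]
          linarith [hw.1]
        have e4 : K w = (((2 * (g w).re) / (m * (2 * w.re)) : ℝ) : ℂ) := by
          rw [hK]
          simp only [if_neg hw2]
          have hg0 : g w ≠ 0 := by
            intro h0
            have := h.norm_eq_one w hw
            rw [h0, norm_zero] at this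
            exact zero_ne_one this
          rw [hunit w hwn, hunit (g w) (h.norm_eq_one w hw), ← mul_assoc, mul_comm (ρ w) w, hm,
            mul_comm (m : ℂ), mul_assoc, mul_div_mul_left _ _ hg0]
          norm_cast
        rw [e4, Complex.ofReal_im])
  have hI : Complex.I ∈ halfDisk := by simp [halfDisk]
  have hc1 := hcst _ hI
  rw [show K Complex.I = 1 from if_pos Complex.I_sq] at hc1
  have hz1 := hcst z (interior_subset hz)
  rw [← hc1] at hz1
  have hz2 : K z = _ := if_neg (hint z hz)
  rw [hz2] at hz1
  exact (div_eq_one_iff_eq (hden z (interior_subset hz) (hint z hz))).1 hz1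

/-- The immersion is the restriction of an automorphism of the disk preserving the diameter. -/
theorem exists_eq_mobius : ∃ s : ℝ, -1 < s ∧ s < 1 ∧
    ∀ z ∈ halfDisk, g z - z = s * Complex.I * (1 + g z * z) := by
  have hden : ∀ z ∈ interior halfDisk, 1 + g z * z ≠ 0 := by
    intro z hz h0
    have h1 : g z * z = -1 := by linear_combination h0
    have h2 := congrArg norm h1
    rw [norm_mul, norm_neg, norm_one] at h2
    have h3 := h.norm_le_one z (interior_subset hz)
    have h4 : ‖z‖ < 1 := by
      rw [← sq_lt_one_iff₀ (norm_nonneg z), Complex.sq_norm, Complex.normSq_apply]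
      linarith [(mem_interior_halfDisk.1 hz).1]
    nlinarith [norm_nonneg (g z), norm_nonneg z]
  -- This function is the tangent of `arctan g - arctan z`; its derivative vanishes by
  -- `one_add_sq_eq`.
  have hder : ∀ z ∈ interior halfDisk,
      HasDerivAt (fun w => (g w - w) / (1 + g w * w)) 0 z := by
    intro z hz
    have hgz := h.hasDerivAt hz
    refine ((hgz.sub (hasDerivAt_id z)).div ((hgz.mul (hasDerivAt_id z)).const_add 1)
      (hden z hz)).congr_deriv ?_
    simp only [id]
    rw [div_eq_zero_iff]
    left
    have := h.one_add_sq_eq hz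
    simp
    linear_combination -this
  obtain ⟨c, hc⟩ := isOpen_interior.exists_is_const_of_deriv_eq_zero
    convex_halfDisk.interior.isPreconnected
    (fun z hz => (hder z hz).differentiableAt.differentiableWithinAt) (fun z hz => (hder z hz).deriv)
  have hEq : Set.EqOn (fun z => g z - z) (fun z => c * (1 + g z * z)) halfDisk := by
    refine Set.EqOn.of_subset_closure (s := interior halfDisk) ?_
      (h.continuousOn.sub continuousOn_id)
      (continuousOn_const.mul (continuousOn_const.add (h.continuousOn.mul continuousOn_id)))
      interior_subset closure_interior_halfDisk.ge
    intro z hz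
    exact (div_eq_iff (hden z hz)).1 (hc z hz)
  -- The constant is `g 0`, imaginary and strictly between the corner values `-i` and `i`.
  have h0 : (0 : ℂ) ∈ diameterSide := by simp [diameterSide]
  have hc0 : g 0 = c := by simpa using hEq (diameterSide_subset h0)
  have hcI : c = ((g 0).im : ℂ) * Complex.I := by
    rw [← hc0]; exact Complex.ext (by simp [h.re_eq_zero 0 h0]) (by simp)
  have m1 := h.strictMonoOn_im (show (-1 : ℝ) ∈ Set.Icc (-1 : ℝ) 1 by norm_num)
    (show (0 : ℝ) ∈ Set.Icc (-1 : ℝ) 1 by norm_num) (by norm_num)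
  have m2 := h.strictMonoOn_im (show (0 : ℝ) ∈ Set.Icc (-1 : ℝ) 1 by norm_num)
    (show (1 : ℝ) ∈ Set.Icc (-1 : ℝ) 1 by norm_num) (by norm_num)
  simp [h.corner_values.1, h.corner_values.2] at m1 m2
  exact ⟨(g 0).im, m1, m2, fun z hz => by rw [← hcI]; exact hEq hz⟩

end IsHalfDiskImmersion

/-- The quantity is `|1 - s i z|²`, the squared denominator of the automorphism `z ↦ (z + s i) / (1
- s i z)`. -/
theorem normSq_one_sub_pos {s : ℝ} (h1 : -1 < s) (h2 : s < 1) {z : ℂ} (hz : z ∈ halfDisk) :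
    0 < (1 + s * z.im) ^ 2 + (s * z.re) ^ 2 := by
  have hy : z.im ^ 2 ≤ 1 := by nlinarith [hz.1, sq_nonneg z.re]
  have hs : s ^ 2 < 1 := by nlinarith
  have : 0 < 1 + s * z.im := by
    have : (s * z.im) ^ 2 < 1 := by
      rw [mul_pow]; nlinarith [sq_nonneg s, sq_nonneg z.im]
    nlinarith [(sq_lt_one_iff_abs_lt_one _).1 this, abs_lt.1 ((sq_lt_one_iff_abs_lt_one _).1 this)]
  positivity

/-- The disk automorphisms preserving the imaginary diameter map the half disk to itself. -/
theorem mem_halfDisk_of_mobius {s : ℝ} (h1 : -1 < s) (h2 : s < 1) {z w : ℂ} (hz : z ∈ halfDisk)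
    (h : w - z = s * Complex.I * (1 + w * z)) : w ∈ halfDisk := by
  have hD := normSq_one_sub_pos h1 h2 hz
  have hs : 0 < 1 - s ^ 2 := by nlinarith
  have hre := congrArg Complex.re h
  have him := congrArg Complex.im h
  simp at hre him
  have er : w.re * ((1 + s * z.im) ^ 2 + (s * z.re) ^ 2) = z.re * (1 - s ^ 2) := by
    linear_combination (1 + s * z.im) * hre - s * z.re * him
  have en : (w.re ^ 2 + w.im ^ 2) * ((1 + s * z.im) ^ 2 + (s * z.re) ^ 2) =
      z.re ^ 2 + (z.im + s) ^ 2 := by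
    have e1 : w.re * (1 + s * z.im) + s * z.re * w.im = z.re := by linear_combination hre
    have e2 : w.im * (1 + s * z.im) - s * z.re * w.re = z.im + s := by linear_combination him
    calc _ = (w.re * (1 + s * z.im) + s * z.re * w.im) ^ 2 +
          (w.im * (1 + s * z.im) - s * z.re * w.re) ^ 2 := by ring
      _ = _ := by rw [e1, e2]
  refine ⟨?_, ?_⟩
  · refine le_of_mul_le_mul_right ?_ hD
    rw [en]
    -- The gap is `|1 - s i z|² - |z + s i|² = (1 - s²)(1 - |z|²)`.
    nlinarith [mul_nonneg hs.le (sub_nonneg.2 hz.1)]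
  · refine le_of_mul_le_mul_right ?_ hD
    rw [er, zero_mul]
    exact mul_nonneg hz.2 hs.le

theorem one_sub_ne_zero {s : ℝ} (h1 : -1 < s) (h2 : s < 1) {z : ℂ} (hz : z ∈ halfDisk) :
    1 - s * Complex.I * z ≠ 0 := by
  intro h0
  have hD := normSq_one_sub_pos h1 h2 hz
  have hre := congrArg Complex.re h0
  have him := congrArg Complex.im h0
  simp at hre him
  have e1 : 1 + s * z.im = 0 := by linarith
  have e2 : s * z.re = 0 := by simpa using him
  rw [e1, e2] at hD
  norm_num at hD

theorem IsHalfDiskImmersion.image_eq {g ρ : ℂ → ℂ} (h : IsHalfDiskImmersion g ρ) :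
    g '' halfDisk = halfDisk := by
  obtain ⟨s, h1, h2, hs⟩ := h.exists_eq_mobius
  refine Set.Subset.antisymm ?_ fun w hw => ?_
  · rintro _ ⟨z, hz, rfl⟩
    exact mem_halfDisk_of_mobius h1 h2 hz (hs z hz)
  · have h1' : -1 < -s := by linarith
    have h2' : -s < 1 := by linarith
    have hne := one_sub_ne_zero h1' h2' hw
    -- The preimage of `w` under the automorphism, given by the automorphism with parameter `-s`.
    set z := (w - s * Complex.I) / (1 - ((-s : ℝ) : ℂ) * Complex.I * w) with hz
    rw [eq_div_iff hne] at hz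
    push_cast at hz
    have hzD : z ∈ halfDisk := by
      refine mem_halfDisk_of_mobius h1' h2' hw ?_
      push_cast
      linear_combination hz
    refine ⟨z, hzD, mul_right_cancel₀ (one_sub_ne_zero h1 h2 hzD) ?_⟩
    linear_combination hs z hzD + hz

/-! ### Assembling the flat Y-cone -/

theorem IsConformalHarmonic.isHalfDiskImmersion {f X Y P Q : ℂ → Space3}
    (h : IsConformalHarmonic f X Y P Q) {a e : Space3} {L : ℝ} (hL : 0 < L)
    (ha : inner ℝ a a = 1) (he : inner ℝ e e = 1) (hae : inner ℝ a e = 0) (hX0 : X 0 = L • a)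
    (hXY : ∀ z ∈ halfDisk, X z = inner ℝ (X z) a • a - inner ℝ (Y z) a • e ∧
      Y z = inner ℝ (Y z) a • a + inner ℝ (X z) a • e)
    (hf : ∀ z ∈ halfDisk, f z = (planeCoord a e f z).re • a + (planeCoord a e f z).im • e)
    (hdiam : ∀ z ∈ diameterSide, inner ℝ (f z) a = 0)
    (hball : ∀ z ∈ halfDisk, ‖f z‖ ≤ 1) (hnorm : ∀ z ∈ arcSide, ‖f z‖ = 1)
    (horth : ∀ z ∈ arcSide, outerConormal f z z ∈ Submodule.span ℝ {f z}) :
    IsHalfDiskImmersion (planeCoord a e f) (planeCoordDeriv a X Y) := by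
  have hn : ∀ z ∈ halfDisk, ‖planeCoord a e f z‖ = ‖f z‖ := by
    intro z hz
    rw [← sq_eq_sq₀ (norm_nonneg _) (norm_nonneg _), Complex.sq_norm, Complex.normSq_apply,
      ← real_inner_self_eq_norm_sq]
    have hea : inner ℝ e a = 0 := by rw [real_inner_comm, hae]
    have hfz := hf z hz
    generalize planeCoord a e f z = w at *
    rw [hfz]
    simp only [inner_add_left, inner_add_right, real_inner_smul_left, real_inner_smul_right, ha,
      he, hae, hea]
    ring
  refine ⟨fun z hz => h.hasDerivWithinAt_planeCoord hz he hae (hXY z hz).1 (hXY z hz).2,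
    ?_, ?_, ?_, fun z hz => by rw [hn z (arcSide_subset hz), hnorm z hz], ?_, ?_,
    fun z hz => by rw [hn z hz]; exact hball z hz⟩
  · have hX := h.continuousOn_X
    have hY := h.continuousOn_Y
    unfold planeCoordDeriv
    fun_prop
  · intro z hz h0
    have hre := congrArg Complex.re h0
    have him := congrArg Complex.im h0
    simp [planeCoordDeriv] at hre him
    have hX : X z = 0 := by rw [(hXY z hz).1, hre, him]; simp
    have := h.pos z hz
    rw [hX, inner_zero_left] at this
    exact this.false
  · intro z hz
    simp [planeCoord, hdiam z hz]
  · intro z hz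
    have hzD := arcSide_subset hz
    obtain ⟨m, -, hm⟩ := h.radial_eq_smul hz (horth z hz)
    rw [planarDeriv_apply] at hm
    have hma := congrArg (fun v => inner ℝ v a) hm
    have hme := congrArg (fun v => inner ℝ v e) hm
    simp only [inner_add_left, real_inner_smul_left] at hma hme
    have hXe : inner ℝ (X z) e = -inner ℝ (Y z) a := by
      conv_lhs => rw [(hXY z hzD).1]
      rw [inner_sub_left, real_inner_smul_left, real_inner_smul_left, hae, he]; ring
    have hYe : inner ℝ (Y z) e = inner ℝ (X z) a := by
      conv_lhs => rw [(hXY z hzD).2]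
      rw [inner_add_left, real_inner_smul_left, real_inner_smul_left, hae, he]; ring
    rw [hXe, hYe] at hme
    refine ⟨m, Complex.ext ?_ ?_⟩
    · simp [planeCoord, planeCoordDeriv]; linarith
    · simp [planeCoord, planeCoordDeriv]; linarith
  · simp only [planeCoordDeriv, hX0, real_inner_smul_left, ha]
    simpa using hL

/-- The parametrization of a plane by two vectors. -/
def planeMap (a e : Space3) (w : ℂ) : Space3 := w.re • a + w.im • e

/-- A free boundary harmonic `Y` in the unit ball consists of three flat half disks. -/
theorem IsHarmonicY.exists_image_eq {f X Y P Q : Fin 3 → ℂ → Space3} (h : IsHarmonicY f X Y P Q)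
    (hball : ∀ j, ∀ z ∈ halfDisk, ‖f j z‖ ≤ 1) (hnorm : ∀ j, ∀ z ∈ arcSide, ‖f j z‖ = 1)
    (horth : ∀ j, ∀ z ∈ arcSide, outerConormal (f j) z z ∈ Submodule.span ℝ {f j z}) :
    ∃ (a : Fin 3 → Space3) (e : Space3), (∀ j, inner ℝ (a j) (a j) = 1) ∧
      (∀ i j, i ≠ j → inner ℝ (a i) (a j) = -1 / 2) ∧ a 0 + a 1 + a 2 = 0 ∧
      (∀ j, inner ℝ (a j) e = 0) ∧ inner ℝ e e = 1 ∧
      ∀ j, f j '' halfDisk = planeMap (a j) e '' halfDisk := by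
  have h0 : (0 : ℂ) ∈ diameterSide := by simp [diameterSide]
  have h0D := diameterSide_subset h0
  set E := inner ℝ (Y 0 0) (Y 0 0) with hE
  have hEpos : 0 < E := h.inner_Y_pos h0 0
  -- The common length of all `X j 0` and `Y j 0`, by conformality and the agreement of the `Y j` on
  -- the diameter.
  set L := √E
  have hL : 0 < L := Real.sqrt_pos.2 hEpos
  have hLL : L⁻¹ * (L⁻¹ * E) = 1 := by
    have : L * L = E := Real.mul_self_sqrt hEpos.le
    rw [← this]; field_simp
  set a : Fin 3 → Space3 := fun j => L⁻¹ • X j 0 with ha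
  set e : Space3 := L⁻¹ • Y 0 0 with he
  have haa : ∀ j, inner ℝ (a j) (a j) = 1 := fun j => by
    rw [ha, real_inner_smul_left, real_inner_smul_right, h.inner_X_self h0 j 0, hLL]
  have hab : ∀ i j, i ≠ j → inner ℝ (a i) (a j) = -1 / 2 := fun i j hij => by
    rw [ha, real_inner_smul_left, real_inner_smul_right, h.inner_X h0 hij 0, ← hE]
    linear_combination (-1 / 2) * hLL
  have hee : inner ℝ e e = 1 := by rw [he, real_inner_smul_left, real_inner_smul_right, hLL]
  have hae : ∀ j, inner ℝ (a j) e = 0 := fun j => by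
    rw [ha, he, real_inner_smul_left, real_inner_smul_right, h.eqOn_Y 0 j h0,
      (h.face j).inner_X_Y 0 h0D, mul_zero, mul_zero]
  have hX0 : ∀ j, X j 0 = L • a j := fun j => (smul_inv_smul₀ hL.ne' _).symm
  have hY0 : ∀ j, Y j 0 = L • e := fun j => by
    rw [he, smul_inv_smul₀ hL.ne', h.eqOn_Y j 0 h0]
  have hXY : ∀ j, ∀ z ∈ halfDisk,
      X j z = inner ℝ (X j z) (a j) • a j - inner ℝ (Y j z) (a j) • e ∧
      Y j z = inner ℝ (Y j z) (a j) • a j + inner ℝ (X j z) (a j) • e := fun j z hz =>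
    (h.face j).partials_eq (h.hopf_eq_zero hnorm horth j) hL.ne' (haa j) (hae j) (hX0 j) (hY0 j) hz
  have hf : ∀ j, ∀ z ∈ halfDisk, f j z =
      (planeCoord (a j) e (f j) z).re • a j + (planeCoord (a j) e (f j) z).im • e := fun j z hz =>
    (h.face j).eq_planeCoord (haa j) hee (hae j) (hXY j) (horth j) hz
  -- A junction point lies in the planes of two different faces. Its components along `a i` and `a
  -- j` are each `-1/2` times the other, so both vanish.
  have hdiam : ∀ j, ∀ z ∈ diameterSide, inner ℝ (f j z) (a j) = 0 := by
    intro j z hz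
    obtain ⟨i, hij⟩ : ∃ i : Fin 3, i ≠ j := exists_ne j
    have key : ∀ i j : Fin 3, i ≠ j → inner ℝ (f j z) (a j) = -(inner ℝ (f i z) (a i)) / 2 := by
      intro i j hij
      have hea : inner ℝ e (a j) = 0 := by rw [real_inner_comm, hae]
      have e1 := congrArg (fun v => inner ℝ v (a j)) (hf i z (diameterSide_subset hz))
      simp only [inner_add_left, real_inner_smul_left, hab i j hij, hea] at e1
      rw [h.eqOn i j hz] at e1
      rw [e1]
      simp [planeCoord]
      ring
    have k1 := key i j hij
    have k2 := key j i hij.symm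
    linarith
  refine ⟨a, e, haa, hab, ?_, hae, hee, fun j => ?_⟩
  · simp only [ha]
    rw [← smul_add, ← smul_add, h.sum_X h0, smul_zero]
  · have himm := (h.face j).isHalfDiskImmersion hL (haa j) hee (hae j) (hX0 j) (hXY j) (hf j)
      (hdiam j) (hball j) (hnorm j) (horth j)
    conv_rhs => rw [← himm.image_eq, Set.image_image]
    exact Set.image_congr (hf j)

theorem isFlatYCone_of_planeMap {a : Fin 3 → Space3} {e : Space3}
    (haa : ∀ j, inner ℝ (a j) (a j) = 1) (hab : ∀ i j, i ≠ j → inner ℝ (a i) (a j) = -1 / 2)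
    (hsum : a 0 + a 1 + a 2 = 0) (hae : ∀ j, inner ℝ (a j) e = 0) (hee : inner ℝ e e = 1) :
    IsFlatYCone (⋃ j, planeMap (a j) e '' halfDisk) := by
  have h3 : √3 * √3 = (3 : ℝ) := Real.mul_self_sqrt (by norm_num)
  have h30 : √3 ≠ (0 : ℝ) := by positivity
  -- The third frame vector: `a 1 - a 2` is orthogonal to `a 0` and `e` and has length `√3`. In this
  -- frame `a j` is `a 0` rotated towards `b` by `2πj/3`, matching `faceEmbedding`.
  set b : Space3 := (√3)⁻¹ • (a 1 - a 2) with hb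
  have h01 := hab 0 1 (by decide)
  have h02 := hab 0 2 (by decide)
  have h12 := hab 1 2 (by decide)
  have h21 := hab 2 1 (by decide)
  have hbb : inner ℝ b b = 1 := by
    rw [hb]
    simp only [real_inner_smul_left, real_inner_smul_right, inner_sub_left, inner_sub_right, haa,
      h12, h21]
    field_simp
    rw [sq, h3]; norm_num
  have hab' : inner ℝ (a 0) b = 0 := by
    rw [hb, real_inner_smul_right, inner_sub_right, h01, h02]; ring
  have heb : inner ℝ e b = 0 := by
    rw [real_inner_comm, hb, real_inner_smul_left, inner_sub_left, hae, hae]; ring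
  have hon : Orthonormal ℝ ![a 0, e, b] := by
    rw [orthonormal_iff_ite]
    have c1 := real_inner_comm (a 0) e
    have c2 := real_inner_comm (a 0) b
    have c3 := real_inner_comm e b
    intro i j
    fin_cases i <;> fin_cases j <;> simp [-inner_self_eq_norm_sq_to_K] <;>
      first | exact haa 0 | exact hee | exact hbb | exact hae 0 | exact hab' | exact heb | linarith [hae 0]
  have hcard : Fintype.card (Fin 3) = Module.finrank ℝ Space3 := by simp
  set B : OrthonormalBasis (Fin 3) ℝ Space3 :=
    (basisOfOrthonormalOfCardEqFinrank hon hcard).toOrthonormalBasis (by simpa using hon) with hB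
  have hBv : ∀ i, B i = ![a 0, e, b] i := fun i => by simp [hB]
  have hR : ∀ j, ∀ w, B.repr.symm (faceEmbedding j w) = planeMap (a j) e w := by
    intro j w
    have hbs : √3 • b = a 1 - a 2 := by rw [hb, smul_inv_smul₀ h30]
    have ha2 : a 2 = -a 0 - a 1 := by rw [← sub_eq_zero, ← hsum]; abel
    rw [← B.sum_repr_symm, Fin.sum_univ_three, hBv, hBv, hBv]
    have key : Real.cos (2 * Real.pi * (j : ℝ) / 3) • a 0 +
        Real.sin (2 * Real.pi * (j : ℝ) / 3) • b = a j := by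
      have c1 : Real.cos (2 * Real.pi / 3) = -1 / 2 := by
        rw [show 2 * Real.pi / 3 = Real.pi - Real.pi / 3 by ring, Real.cos_pi_sub,
          Real.cos_pi_div_three]; norm_num
      have s1 : Real.sin (2 * Real.pi / 3) = √3 / 2 := by
        rw [show 2 * Real.pi / 3 = Real.pi - Real.pi / 3 by ring, Real.sin_pi_sub,
          Real.sin_pi_div_three]
      have c2 : Real.cos (2 * Real.pi * 2 / 3) = -1 / 2 := by
        rw [show 2 * Real.pi * 2 / 3 = Real.pi / 3 + Real.pi by ring, Real.cos_add_pi,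
          Real.cos_pi_div_three]; norm_num
      have s2 : Real.sin (2 * Real.pi * 2 / 3) = -(√3 / 2) := by
        rw [show 2 * Real.pi * 2 / 3 = Real.pi / 3 + Real.pi by ring, Real.sin_add_pi,
          Real.sin_pi_div_three]
      fin_cases j
      · simp
      · simp [c1, s1]
        rw [show (√3 / 2) • b = (1 / 2 : ℝ) • (√3 • b) by module, hbs, ha2]
        module
      · simp [c2, s2]
        rw [show (√3 / 2) • b = (1 / 2 : ℝ) • (√3 • b) by module, hbs, ha2]
        module
    rw [planeMap, ← key]
    simp [faceEmbedding, mul_smul]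
    abel
  refine ⟨B.repr.symm, ?_⟩
  rw [standardYCone, Set.image_iUnion]
  refine Set.iUnion_congr fun j => ?_
  rw [Set.image_image]
  exact Set.image_congr fun w _ => (hR j w).symm

theorem theorem1p1 (u : Space3 → Space3)
    (hball : Set.MapsTo u standardYCone (Metric.closedBall (0 : Space3) 1))
    (hconf : IsConformalYImmersion u)
    (hmin : IsMinimalYSurface u)
    (horth : MeetsSphereOrthogonally u) :
    IsFlatYCone (u '' standardYCone) := by
  have hY : IsHarmonicY (faceMap u) (fun j => facePartial 0 (faceMap u j))
      (fun j => facePartial 1 (faceMap u j))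
      (fun j => facePartial 0 (facePartial 0 (faceMap u j)))
      (fun j => facePartial 0 (facePartial 1 (faceMap u j))) := by
    refine ⟨fun j => isConformalHarmonic_of_minimal (hconf j).1 (hconf j).2 (hmin.1 j),
      fun i j z hz => ?_, hmin.2⟩
    simp [faceMap, faceEmbedding, hz.1]
  obtain ⟨a, e, haa, hab, hsum, hae, hee, himg⟩ := hY.exists_image_eq
    (fun j z hz => mem_closedBall_zero_iff.1
      (hball (Set.mem_iUnion.2 ⟨j, Set.mem_image_of_mem _ hz⟩)))
    (fun j z hz => by simpa using (horth j z hz).1) (fun j z hz => (horth j z hz).2)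
  have : u '' standardYCone = ⋃ j, planeMap (a j) e '' halfDisk := by
    rw [standardYCone, Set.image_iUnion]
    refine Set.iUnion_congr fun j => ?_
    rw [Set.image_image, ← himg j]
    rfl
  rw [this]
  exact isFlatYCone_of_planeMap haa hab hsum hae hee
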